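/- For a polynomial $f\in\mathbb{C}[h]$ let $\mathcal{H}(f)$ be the unital associative $\mathbb{C}$-algebra generated by $x,y,h$ with the relations $hx=xf(h)$, $yh=f(h)y$, $yx-xy=f(h)-h$. Let $n>1$, let $w\in\mathbb{C}$ be a primitive $n$-th root of unity, let $c\in\mathbb{C}$, and let $f=wh+c$. Put $e=c/(1-w)$, the fixed point of $f$. Then every irreducible $\mathcal{H}(f)$-module is finite-dimensional over $\mathbb{C}$ and is isomorphic to one of the following modules: (a) $\mathbb{C}v$ with $xv=av$, $hv=ev$, $yv=bv$, where $a,b\in\mathbb{C}$; (b) $A'(b,\dot z,a)=\mathbb{C}[t,t^{-1}]/(t^n-a)$, where $a,b\in\mathbb{C}^*$, $\dot z\in\mathbb{C}$, with $$ht^i=(e+bw^i)t^i,\quad xt^i=t^{i+1},\quad yt^i=(e+bw^i+\dot z)t^{i-1}\qquad(i\in\mathbb{Z});$$ (c) $B'(b,j,a)=\mathbb{C}[t,t^{-1}]/(t^n-a)$, where $a,b\in\mathbb{C}^*$, $j\in\mathbb{Z}$, with $$ht^i=(e+bw^i)t^i,\quad xt^i=b(w^{i+1}-w^j)t^{i+1},\quad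 yt^i=t^{i-1}\qquad(i\in\mathbb{Z});$$ (d) $C(\dot z)=\mathbb{C}[t]/(t^n)$, where $\dot z\in\mathbb{C}$, $\dot z\neq -e$, with $$ht^i=(e-w^i(\dot z+e))t^i,\quad xt^i=t^{i+1},\quad yt^i=(1-w^i)(\dot z+e)t^{i-1}\qquad(0\le i\le n-1),$$ where $t^n=0$ and $y\cdot 1=0$. Conversely, all these modules are irreducible; those in (a) have dimension $1$ and those in (b), (c), (d) have dimension $n$. Modules from different families are never isomorphic. Within the families: two modules (a) are isomorphic if and only if they have the same $(a,b)$; $A'(b,\dot z,a)\cong A'(b',\dot z',a')$ if and only if $\dot z=\dot z'$, $a=a'$ and $b'=bw^k$ for some $k\in\mathbb{Z}$; $B'(b,j,a)\cong B'(b',j',a')$ if and only if $bw^j=b'w^{j'}$ and $a=a'$; $C(\dot z)\cong C(\dot z')$ if and only if $\dot z=\dot z'$. -/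

import Mathlib

open Polynomial LaurentPolynomial

noncomputable section

namespace GenHeisenberg

/-! ### The generalized Heisenberg algebra -/

/-- The three generators `x, h, y`. -/
inductive Gen : Type
  | x | h | y

/-- The free generators of `ℂ⟨x, h, y⟩`. -/
abbrev gen (g : Gen) : FreeAlgebra ℂ Gen := FreeAlgebra.ι ℂ g

/-- The defining relations `h x = x f(h)`, `y h = f(h) y`, `[y, x] = f(h) - h`. -/
inductive Rel (f : ℂ[X]) : FreeAlgebra ℂ Gen → FreeAlgebra ℂ Gen → Prop
  | hx : Rel f (gen .h * gen .x) (gen .x * aeval (gen .h) f)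
  | yh : Rel f (gen .y * gen .h) (aeval (gen .h) f * gen .y)
  | yx : Rel f (gen .y * gen .x - gen .x * gen .y) (aeval (gen .h) f - gen .h)

/-- The generalized Heisenberg algebra `𝓗(f)`: the associative unital `ℂ`-algebra generated by
`x, h, y` subject to `h x = x f(h)`, `y h = f(h) y`, `[y, x] = f(h) - h`. -/
def H (f : ℂ[X]) : Type := RingQuot (Rel f)

instance (f : ℂ[X]) : Ring (H f) := inferInstanceAs (Ring (RingQuot (Rel f)))

instance (f : ℂ[X]) : Algebra ℂ (H f) := inferInstanceAs (Algebra ℂ (RingQuot (Rel f)))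

/-- The quotient map `ℂ⟨x, h, y⟩ → 𝓗(f)`. -/
def H.mk (f : ℂ[X]) : FreeAlgebra ℂ Gen →ₐ[ℂ] H f := RingQuot.mkAlgHom ℂ (Rel f)

/-- The generators `x, h, y` of `𝓗(f)`. -/
def H.gen (f : ℂ[X]) (g : Gen) : H f := H.mk f (FreeAlgebra.ι ℂ g)

/-! ### Modules given by three operators -/

/-- Three linear operators on a complex vector space that satisfy the defining relations of
`𝓗(f)`. -/
structure Rep (f : ℂ[X]) (M : Type*) [AddCommGroup M] [Module ℂ M] where
  /-- the operator of `x` -/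
  opX : Module.End ℂ M
  /-- the operator of `h` -/
  opH : Module.End ℂ M
  /-- the operator of `y` -/
  opY : Module.End ℂ M
  hx : opH * opX = opX * aeval opH f
  yh : opY * opH = aeval opH f * opY
  yx : opY * opX - opX * opY = aeval opH f - opH

namespace Rep

variable {f : ℂ[X]} {M : Type*} [AddCommGroup M] [Module ℂ M]

/-- The operator by which a generator acts. -/
def op (R : Rep f M) : Gen → Module.End ℂ M
  | .x => R.opX
  | .h => R.opH
  | .y => R.opY

/-- The algebra homomorphism `𝓗(f) → End(M)` that sends the generators to the given operators. -/
def toAlgHom (R : Rep f M) : H f →ₐ[ℂ] Module.End ℂ M :=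
  RingQuot.liftAlgHom ℂ ⟨FreeAlgebra.lift ℂ R.op, by
    intro a b hab
    have key : FreeAlgebra.lift ℂ R.op (aeval (gen Gen.h) f) = aeval R.opH f := by
      rw [← aeval_algHom_apply]
      simp [op]
    cases hab with
    | hx => simpa [key, op] using R.hx
    | yh => simpa [key, op] using R.yh
    | yx => simpa [key, op] using R.yx⟩

theorem toAlgHom_gen (R : Rep f M) (g : Gen) : R.toAlgHom (H.gen f g) = R.op g := by
  have := RingQuot.liftAlgHom_mkAlgHom_apply (S := ℂ) (s := Rel f) (FreeAlgebra.lift ℂ R.op)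
  simp only [toAlgHom, H.gen, H.mk]
  erw [this]
  simp

/-- The `𝓗(f)`-module with underlying space `M` on which `x, h, y` act by the given operators. -/
def Space (_R : Rep f M) : Type _ := M

instance (R : Rep f M) : AddCommGroup R.Space := inferInstanceAs (AddCommGroup M)

instance (R : Rep f M) : Module ℂ R.Space := inferInstanceAs (Module ℂ M)

instance (R : Rep f M) : Module (H f) R.Space :=
  Module.compHom (R := Module.End ℂ M) M R.toAlgHom.toRingHom

/-- The identity of `M`, as a linear equivalence onto the underlying space of the module. -/
def of (R : Rep f M) : M ≃ₗ[ℂ] R.Space := LinearEquiv.refl ℂ M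

theorem gen_smul (R : Rep f M) (g : Gen) (v : M) : H.gen f g • R.of v = R.of (R.op g v) := by
  change R.toAlgHom (H.gen f g) v = R.op g v
  rw [toAlgHom_gen]

instance (R : Rep f M) : IsScalarTower ℂ (H f) R.Space :=
  ⟨fun r u v => by
    change R.toAlgHom (r • u) v = r • R.toAlgHom u v
    rw [map_smul]
    rfl⟩

/-- A linear subspace that is stable under the three operators, as an `𝓗(f)`-submodule. -/
def sub (R : Rep f M) (W : Submodule ℂ M) (hW : ∀ g, ∀ v ∈ W, R.op g v ∈ W) :
    Submodule (H f) R.Space where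
  carrier := {v | (show M from v) ∈ W}
  add_mem' := fun ha hb => W.add_mem ha hb
  zero_mem' := W.zero_mem
  smul_mem' := by
    intro u v hv
    change R.toAlgHom u v ∈ W
    change v ∈ W at hv
    obtain ⟨p, rfl⟩ := RingQuot.mkAlgHom_surjective ℂ (Rel f) u
    induction p using FreeAlgebra.induction generalizing v with
    | grade0 r =>
      have : R.toAlgHom (RingQuot.mkAlgHom ℂ (Rel f) (algebraMap ℂ _ r)) v = r • v := by
        rw [AlgHom.commutes]
        erw [AlgHom.commutes]
        rfl
      rw [this]
      exact W.smul_mem r hv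
    | grade1 g =>
      have := R.toAlgHom_gen g
      change R.toAlgHom (H.gen f g) v ∈ W
      rw [this]
      exact hW g v hv
    | mul a b ha hb =>
      have : R.toAlgHom (RingQuot.mkAlgHom ℂ (Rel f) (a * b)) v =
          R.toAlgHom (RingQuot.mkAlgHom ℂ (Rel f) a)
            (R.toAlgHom (RingQuot.mkAlgHom ℂ (Rel f) b) v) := by
        rw [map_mul]
        erw [map_mul]
        rfl
      rw [this]
      exact ha (hb hv)
    | add a b ha hb =>
      have : R.toAlgHom (RingQuot.mkAlgHom ℂ (Rel f) (a + b)) v =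
          R.toAlgHom (RingQuot.mkAlgHom ℂ (Rel f) a) v +
            R.toAlgHom (RingQuot.mkAlgHom ℂ (Rel f) b) v := by
        rw [map_add]
        erw [map_add]
        rfl
      rw [this]
      exact W.add_mem (ha hv) (hb hv)

end Rep

theorem aeval_apply_eigen {M : Type*} [AddCommGroup M] [Module ℂ M] (φ : Module.End ℂ M) (p : ℂ[X])
    (μ : ℂ) (v : M) (hv : φ v = μ • v) : aeval φ p v = p.eval μ • v := by
  induction p using Polynomial.induction_on' with
  | add p q hp hq => simp [hp, hq, add_smul]
  | monomial k a =>
    have : ∀ k : ℕ, (φ ^ k) v = μ ^ k • v := by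
      intro k
      induction k with
      | zero => simp
      | succ k ih => rw [pow_succ, Module.End.mul_apply, hv, map_smul, ih, smul_smul, pow_succ']
    simp [aeval_monomial, this, smul_smul, mul_comm]

/-! ### One-dimensional modules -/

/-- The operators `x = a`, `h = e`, `y = b` on `ℂ`, where `f(e) = e`. -/
def repOne (f : ℂ[X]) (e : ℂ) (he : f.eval e = e) (a b : ℂ) : Rep f ℂ where
  opX := a • 1
  opH := e • 1
  opY := b • 1
  hx := by
    have := aeval_apply_eigen (e • (1 : Module.End ℂ ℂ)) f e 1 (by simp)
    ext
    simp [this, he, mul_comm]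
  yh := by
    have := aeval_apply_eigen (e • (1 : Module.End ℂ ℂ)) f e 1 (by simp)
    ext
    simp [this, he, mul_comm]
  yx := by
    have := aeval_apply_eigen (e • (1 : Module.End ℂ ℂ)) f e 1 (by simp)
    ext
    simp [this, he, mul_comm]

/-! ### The modules `A` and `B` on Laurent polynomials and their quotients `A'` and `B'` -/

/-- `S_f`: the two-sided orbits of `f`, that is `λ : ℤ → ℂ` with `f(λ(i)) = λ(i+1)`. -/
def S (f : ℂ[X]) : Set (ℤ → ℂ) := {l | ∀ i, f.eval (l i) = l (i + 1)}

/-- The linear operator `t ^ i ↦ c(i) t ^ (i + d)` on `ℂ[t, t⁻¹]`. -/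
def shift (d : ℤ) (c : ℤ → ℂ) : Module.End ℂ ℂ[T;T⁻¹] :=
  (AddMonoidAlgebra.basis ℤ ℂ).constr ℂ fun i => c i • (T (i + d) : ℂ[T;T⁻¹])

theorem shift_T (d : ℤ) (c : ℤ → ℂ) (i : ℤ) :
    shift d c (T i) = c i • (T (i + d) : ℂ[T;T⁻¹]) := by
  have := (AddMonoidAlgebra.basis ℤ ℂ).constr_basis ℂ
    (fun i => c i • (T (i + d) : ℂ[T;T⁻¹])) i
  rwa [AddMonoidAlgebra.basis_apply] at this

theorem laurent_ext {φ ψ : Module.End ℂ ℂ[T;T⁻¹]} (h : ∀ i, φ (T i) = ψ (T i)) : φ = ψ :=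
  (AddMonoidAlgebra.basis ℤ ℂ).ext fun i => by
    rw [AddMonoidAlgebra.basis_apply]
    exact h i

theorem aeval_shift_T (f : ℂ[X]) (c : ℤ → ℂ) (i : ℤ) :
    aeval (shift 0 c) f (T i) = f.eval (c i) • (T i : ℂ[T;T⁻¹]) :=
  aeval_apply_eigen _ _ _ _ (by rw [shift_T, add_zero])

/-- `A(λ, z)` on `ℂ[t, t⁻¹]`:
`h t^i = λ(i) t^i`, `x t^i = t^(i+1)`, `y t^i = (λ(i) + z) t^(i-1)`. -/
def repA (f : ℂ[X]) (l : S f) (z : ℂ) : Rep f ℂ[T;T⁻¹] where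
  opX := shift 1 fun _ => 1
  opH := shift 0 l.1
  opY := shift (-1) fun i => l.1 i + z
  hx := laurent_ext fun i => by
    simp [Module.End.mul_apply, shift_T, aeval_shift_T, l.2 i]
  yh := laurent_ext fun i => by
    have := l.2 (i - 1)
    simp only [sub_add_cancel] at this
    simp [Module.End.mul_apply, shift_T, aeval_shift_T, smul_smul, ← sub_eq_add_neg, this, mul_comm]
  yx := laurent_ext fun i => by
    simp [Module.End.mul_apply, shift_T, aeval_shift_T, l.2 i, ← sub_smul]

/-- `B(λ, z)` on `ℂ[t, t⁻¹]`:
`h t^i = λ(i) t^i`, `x t^i = (λ(i+1) + z) t^(i+1)`, `y t^i = t^(i-1)`. -/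
def repB (f : ℂ[X]) (l : S f) (z : ℂ) : Rep f ℂ[T;T⁻¹] where
  opX := shift 1 fun i => l.1 (i + 1) + z
  opH := shift 0 l.1
  opY := shift (-1) fun _ => 1
  hx := laurent_ext fun i => by
    simp [Module.End.mul_apply, shift_T, aeval_shift_T, l.2 i, smul_smul, mul_comm]
  yh := laurent_ext fun i => by
    have := l.2 (i - 1)
    simp only [sub_add_cancel] at this
    simp [Module.End.mul_apply, shift_T, aeval_shift_T, ← sub_eq_add_neg, this]
  yx := laurent_ext fun i => by
    simp [Module.End.mul_apply, shift_T, aeval_shift_T, l.2 i, ← sub_smul]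

/-- The subspace `ℂ[t, t⁻¹](t^m - a)` of `ℂ[t, t⁻¹]`. -/
def cyc (m : ℕ) (a : ℂ) : Submodule ℂ ℂ[T;T⁻¹] :=
  (Ideal.span {(T (m : ℤ) - LaurentPolynomial.C a : ℂ[T;T⁻¹])}).restrictScalars ℂ

theorem shift_cyc (m : ℕ) (a : ℂ) (d : ℤ) (c : ℤ → ℂ) (hc : ∀ i, c (i + m) = c i)
    (v : ℂ[T;T⁻¹]) (hv : v ∈ cyc m a) : shift d c v ∈ cyc m a := by
  have hcomm : ∀ q, shift d c ((T (m : ℤ) - LaurentPolynomial.C a) * q) =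
      (T (m : ℤ) - LaurentPolynomial.C a) * shift d c q := by
    let μ := LinearMap.mulLeft ℂ (T (m : ℤ) - LaurentPolynomial.C a : ℂ[T;T⁻¹])
    have : shift d c * μ = μ * shift d c := laurent_ext fun i => by
      simp only [μ, Module.End.mul_apply, LinearMap.mulLeft_apply, shift_T, sub_mul, ← T_add,
        ← LaurentPolynomial.smul_eq_C_mul, map_sub, map_smul]
      rw [add_comm (m : ℤ) i, hc, smul_sub, smul_comm a, show i + (m : ℤ) + d = m + (i + d) by ring]
    exact fun q => LinearMap.congr_fun this q
  obtain ⟨q, rfl⟩ := Ideal.mem_span_singleton'.1 hv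
  rw [mul_comm, hcomm]
  exact Ideal.mul_mem_right _ _ (Ideal.mem_span_singleton_self _)

/-- `ℂ[t, t⁻¹](t^m - a)` as a submodule of `A(λ, z)`, where `m` is a period of `λ`. -/
def subA (f : ℂ[X]) (l : S f) (z : ℂ) (m : ℕ) (hm : ∀ i, l.1 (i + m) = l.1 i) (a : ℂ) :
    Submodule (H f) (repA f l z).Space :=
  (repA f l z).sub (cyc m a) fun g => match g with
    | .x => shift_cyc m a _ _ fun _ => rfl
    | .h => shift_cyc m a _ _ hm
    | .y => shift_cyc m a _ _ fun i => by rw [hm]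

/-- `ℂ[t, t⁻¹](t^m - a)` as a submodule of `B(λ, z)`, where `m` is a period of `λ`. -/
def subB (f : ℂ[X]) (l : S f) (z : ℂ) (m : ℕ) (hm : ∀ i, l.1 (i + m) = l.1 i) (a : ℂ) :
    Submodule (H f) (repB f l z).Space :=
  (repB f l z).sub (cyc m a) fun g => match g with
    | .x => shift_cyc m a _ _ fun i => by rw [add_right_comm, hm]
    | .h => shift_cyc m a _ _ hm
    | .y => shift_cyc m a _ _ fun _ => rfl

/-- `A'(λ, z, a) = A(λ, z) / ℂ[t, t⁻¹](t^m - a)`, where `m` is a period of `λ`. -/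
abbrev A' (f : ℂ[X]) (l : S f) (z : ℂ) (m : ℕ) (hm : ∀ i, l.1 (i + m) = l.1 i) (a : ℂ) : Type :=
  (repA f l z).Space ⧸ subA f l z m hm a

/-- `B'(λ, z, a) = B(λ, z) / ℂ[t, t⁻¹](t^m - a)`, where `m` is a period of `λ`. -/
abbrev B' (f : ℂ[X]) (l : S f) (z : ℂ) (m : ℕ) (hm : ∀ i, l.1 (i + m) = l.1 i) (a : ℂ) : Type :=
  (repB f l z).Space ⧸ subB f l z m hm a

/-! ### The modules `C(z, n)` -/

/-- The value `f^{(i)}(-z)` of the `i`-th iterate of `f` at `-z`. -/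
def iter (f : ℂ[X]) (z : ℂ) (i : ℕ) : ℂ := (fun u => f.eval u)^[i] (-z)

theorem eval_iter (f : ℂ[X]) (z : ℂ) (i : ℕ) : f.eval (iter f z i) = iter f z (i + 1) := by
  simp only [iter, Function.iterate_succ_apply']

/-- The linear operator `t ^ i ↦ c(i) t ^ d(i)` on `ℂ[t]`. -/
def polyOp (d : ℕ → ℕ) (c : ℕ → ℂ) : Module.End ℂ ℂ[X] :=
  (basisMonomials ℂ).constr ℂ fun i => c i • (X ^ d i : ℂ[X])

theorem polyOp_X (d : ℕ → ℕ) (c : ℕ → ℂ) (i : ℕ) :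
    polyOp d c (X ^ i) = c i • (X ^ d i : ℂ[X]) := by
  have := (basisMonomials ℂ).constr_basis ℂ (fun i => c i • (X ^ d i : ℂ[X])) i
  simpa only [polyOp, coe_basisMonomials, ← X_pow_eq_monomial] using this

theorem poly_ext {φ ψ : Module.End ℂ ℂ[X]} (h : ∀ i, φ (X ^ i) = ψ (X ^ i)) : φ = ψ :=
  (basisMonomials ℂ).ext fun i => by
    simpa only [coe_basisMonomials, ← X_pow_eq_monomial] using h i

theorem aeval_polyOp_X (f : ℂ[X]) (c : ℕ → ℂ) (i : ℕ) :
    aeval (polyOp (fun i => i) c) f (X ^ i) = f.eval (c i) • (X ^ i : ℂ[X]) :=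
  aeval_apply_eigen _ _ _ _ (polyOp_X _ _ _)

/-- The operators `h t^i = f^{(i)}(-z) t^i`, `x t^i = t^(i+1)`,
`y t^i = (z + f^{(i)}(-z)) t^(i-1)` on `ℂ[t]`; here `y 1 = 0` because `z + f^{(0)}(-z) = 0`. -/
def repC (f : ℂ[X]) (z : ℂ) : Rep f ℂ[X] where
  opX := polyOp (fun i => i + 1) fun _ => 1
  opH := polyOp (fun i => i) fun i => iter f z i
  opY := polyOp (fun i => i - 1) fun i => z + iter f z i
  hx := poly_ext fun i => by
    simp [Module.End.mul_apply, polyOp_X, aeval_polyOp_X, eval_iter]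
  yh := poly_ext fun i => by
    cases i with
    | zero =>
      have : z + iter f z 0 = 0 := by simp [iter]
      simp only [Module.End.mul_apply, polyOp_X, map_smul, this, zero_smul, smul_zero, map_zero]
    | succ i =>
      simp [Module.End.mul_apply, polyOp_X, aeval_polyOp_X, eval_iter, smul_smul, mul_comm]
  yx := poly_ext fun i => by
    cases i with
    | zero =>
      have h0 : iter f z 0 = -z := by simp [iter]
      have h1 : iter f z 1 = f.eval (-z) := by rw [← h0, eval_iter]
      simp only [LinearMap.sub_apply, Module.End.mul_apply, polyOp_X, aeval_polyOp_X, h0, h1,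
        one_smul, zero_add, Nat.sub_self, add_comm z, neg_add_cancel, zero_smul, map_zero,
        sub_zero, ← sub_smul, sub_neg_eq_add]
    | succ i =>
      simp [Module.End.mul_apply, polyOp_X, aeval_polyOp_X, eval_iter, ← sub_smul]

theorem polyOp_mem (n : ℕ) (d : ℕ → ℕ) (c : ℕ → ℂ)
    (h : ∀ i, n ≤ i → c i = 0 ∨ n ≤ d i) (v : ℂ[X])
    (hv : v ∈ (Ideal.span {(X ^ n : ℂ[X])}).restrictScalars ℂ) :
    polyOp d c v ∈ (Ideal.span {(X ^ n : ℂ[X])}).restrictScalars ℂ := by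
  obtain ⟨q, rfl⟩ := Ideal.mem_span_singleton'.1 hv
  clear hv
  induction q using Polynomial.induction_on' with
  | add p q hp hq =>
    rw [add_mul, map_add]
    exact Submodule.add_mem _ hp hq
  | monomial k a =>
    rw [← C_mul_X_pow_eq_monomial, mul_assoc, ← pow_add, ← Polynomial.smul_eq_C_mul, map_smul, polyOp_X]
    refine Submodule.smul_mem _ _ ?_
    rcases h (k + n) (by omega) with h0 | h0
    · rw [h0, zero_smul]
      exact Submodule.zero_mem _
    · exact Submodule.smul_mem _ _ (Ideal.mem_span_singleton.2 (pow_dvd_pow X h0))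

/-- `(t^n)` as a submodule of `ℂ[t]` with the operators above, where `z + f^{(n)}(-z) = 0`. -/
def subC (f : ℂ[X]) (z : ℂ) (n : ℕ) (hz : z + iter f z n = 0) :
    Submodule (H f) (repC f z).Space :=
  (repC f z).sub ((Ideal.span {(X ^ n : ℂ[X])}).restrictScalars ℂ) fun g => match g with
    | .x => polyOp_mem n _ _ fun i hi => Or.inr (by omega)
    | .h => polyOp_mem n _ _ fun i hi => Or.inr hi
    | .y => polyOp_mem n _ _ fun i hi => by
        rcases hi.eq_or_lt with rfl | hi
        · exact Or.inl hz
        · exact Or.inr (by omega)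

/-- `C(z, n) = ℂ[t]/(t^n)` with `h t^i = f^{(i)}(-z) t^i`, `x t^i = t^(i+1)`,
`y t^i = (z + f^{(i)}(-z)) t^(i-1)`, where `z + f^{(n)}(-z) = 0`. -/
abbrev C' (f : ℂ[X]) (z : ℂ) (n : ℕ) (hz : z + iter f z n = 0) : Type :=
  (repC f z).Space ⧸ subC f z n hz

/-! ### The case `f = w h + c` with `w` a primitive `n`-th root of unity -/

/-- The polynomial `w h + c`. -/
abbrev lin (w c : ℂ) : ℂ[X] := Polynomial.C w * X + Polynomial.C c

/-- The fixed point `c / (1 - w)` of `w h + c`, where `w ≠ 1`. -/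
def fixedPt (w c : ℂ) : ℂ := c / (1 - w)

theorem eval_lin {w : ℂ} (hw : w ≠ 1) (c u : ℂ) :
    (lin w c).eval (fixedPt w c + u) = fixedPt w c + w * u := by
  have : 1 - w ≠ 0 := sub_ne_zero.2 hw.symm
  simp only [lin, fixedPt, eval_add, eval_mul, eval_C, eval_X]
  field_simp
  ring

theorem iter_lin {n : ℕ} (hn : 1 < n) {w : ℂ} (hw : IsPrimitiveRoot w n) (c z : ℂ) : z + iter (lin w c) z n = 0 := by
  have : ∀ i, iter (lin w c) z i = fixedPt w c + w ^ i * (-z - fixedPt w c) := by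
    intro i
    induction i with
    | zero => simp [iter]
    | succ i ih =>
      rw [← eval_iter, ih, eval_lin (hw.ne_one hn)]
      ring
  rw [this, hw.pow_eq_one]
  ring

section Family

variable {n : ℕ} (hn : 1 < n) {w : ℂ} (hw : IsPrimitiveRoot w n) (c : ℂ)

/-- The orbit `λ(i) = c/(1-w) + b w^i` of `w h + c`. -/
def orbit (b : ℂ) : S (lin w c) :=
  ⟨fun i => fixedPt w c + b * w ^ i, fun i => by
    beta_reduce
    rw [eval_lin (hw.ne_one hn), zpow_add_one₀ (hw.ne_zero (by omega))]
    ring⟩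

theorem orbit_period (b : ℂ) (i : ℤ) :
    (orbit hn hw c b).1 (i + n) = (orbit hn hw c b).1 i := by
  simp only [orbit]
  rw [zpow_add₀ (hw.ne_zero (by omega)), zpow_natCast, hw.pow_eq_one, mul_one]

/-- The one-dimensional module `ℂ v` with `x v = a v`, `h v = c/(1-w) v`, `y v = b v`. -/
abbrev OneMod (a b : ℂ) : Type :=
  (repOne (lin w c) (fixedPt w c)
    (by simpa using eval_lin (hw.ne_one hn) c 0) a b).Space

/-- `A'(λ, z, a) = ℂ[t, t⁻¹]/(t^n - a)` for `λ(i) = c/(1-w) + b w^i`, with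
`h t^i = λ(i) t^i`, `x t^i = t^(i+1)`, `y t^i = (λ(i) + z) t^(i-1)`. -/
abbrev AMod (b z a : ℂ) : Type :=
  A' (lin w c) (orbit hn hw c b) z n (orbit_period hn hw c b) a

/-- `B'(λ, z, a) = ℂ[t, t⁻¹]/(t^n - a)` for `λ(i) = c/(1-w) + b w^i` and `z = -λ(j)`, with
`h t^i = λ(i) t^i`, `x t^i = (λ(i+1) + z) t^(i+1) = b (w^(i+1) - w^j) t^(i+1)`,
`y t^i = t^(i-1)`. -/
abbrev BMod (b : ℂ) (j : ℤ) (a : ℂ) : Type :=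
  B' (lin w c) (orbit hn hw c b) (-(orbit hn hw c b).1 j) n (orbit_period hn hw c b) a

/-- `C(z, n) = ℂ[t]/(t^n)` for `f = w h + c`, where `f^{(i)}(-z) = c/(1-w) - w^i (z + c/(1-w))`. -/
abbrev CMod (z : ℂ) : Type :=
  C' (lin w c) z n (iter_lin hn hw c z)

end Family

end GenHeisenberg

end

noncomputable section

namespace GenHeisenberg

/-! ### Schur's lemma in countable dimension -/

/-! Put `U = h - e`. In this coordinate the affine map `f` becomes multiplication by `w`, and the
relations read `U x = w x U`, `y U = w U y`, `y x - x y = (w - 1) U`. Since `w ^ n = 1`, the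
elements `x ^ n`, `y ^ n` and `U ^ n` are central; so is `Z = x y - h`.

An irreducible module is a quotient of the finitely generated algebra `𝓗(f)`, so it has countable
dimension. As `ℂ` is uncountable, Schur's lemma holds without assuming finite dimension
(`exists_eq_smul_of_commute`), and the four central elements act by scalars. The kernel of `U` is a
submodule. If it is everything, then `x` and `y` commute, every generator is a scalar and the
dimension is one. Otherwise `U` has only nonzero eigenvalues, and since `U ^ n` is a scalar, every
nonzero `U`-stable subspace contains an eigenvector. If `x ^ n ≠ 0`, the vectors `x ^ i v` with `i ∈
ℤ` form a copy of `A'`. If `x ^ n = 0` and `y ^ n ≠ 0`, an eigenvector in `ker x` and the powers of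
`y⁻¹` give `B'`. If both vanish, an eigenvector in `ker y` and the powers of `x` give `C`. Each time
the scalar `Z` fixes the remaining coefficients (`exists_hom_aMod`, `exists_hom_bMod`,
`exists_hom_cMod`), and a nonzero map of simple modules is an isomorphism.

The models are irreducible because a `U`-eigenvector in a submodule produces `n` eigenvectors with
distinct eigenvalues `β w ^ (± i)` in dimension `n`. The scalars of the central elements recover the
parameters; dimension and injectivity of `x` or `y` separate the families. -/

theorem isUnit_aeval_of_forall_isUnit {A : Type*} [Ring A] [Algebra ℂ A] (φ : A)
    (h : ∀ μ : ℂ, IsUnit (φ - algebraMap ℂ A μ)) {p : ℂ[X]} (hp : p ≠ 0) : IsUnit (aeval φ p) := by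
  by_contra hu
  rw [(IsAlgClosed.splits p).eq_prod_roots, map_mul, aeval_C] at hu
  have hc : IsUnit (algebraMap ℂ A p.leadingCoeff) :=
    (isUnit_iff_ne_zero.2 (leadingCoeff_ne_zero.2 hp)).map _
  obtain ⟨k, hk, -⟩ := spectrum.exists_mem_of_not_isUnit_aeval_prod fun h' => hu (hc.mul h')
  exact hk (spectrum.mem_resolventSet_iff.2 (by simpa using (h k).neg))

/-- Clearing denominators in a relation among the vectors `(φ - μ)⁻¹ v` gives `p(φ) v = 0` for a
polynomial `p`. As nonzero polynomials in `φ` are invertible, `p = 0`. -/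
theorem linearIndependent_of_forall_sub_apply_eq {V : Type*} [AddCommGroup V] [Module ℂ V]
    (φ : Module.End ℂ V) (h : ∀ μ : ℂ, IsUnit (φ - algebraMap ℂ _ μ)) {v : V} (hv : v ≠ 0)
    (u : ℂ → V) (hu : ∀ μ, (φ - algebraMap ℂ _ μ) (u μ) = v) : LinearIndependent ℂ u := by
  classical
  refine linearIndependent_iff'.2 fun s m hm i hi => ?_
  let q : ℂ → ℂ[X] := fun j => ∏ k ∈ s.erase j, (X - Polynomial.C k)
  let p : ℂ[X] := ∑ j ∈ s, Polynomial.C (m j) * q j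
  have hq : ∀ j ∈ s, aeval φ (∏ k ∈ s, (X - Polynomial.C k)) (u j) = aeval φ (q j) v := by
    intro j hj
    rw [← Finset.prod_erase_mul _ _ hj, map_mul, Module.End.mul_apply]
    congr 1
    rw [← hu j]
    simp
  have hpv : aeval φ p v = 0 := by
    have := congrArg (aeval φ (∏ k ∈ s, (X - Polynomial.C k))) hm
    rw [map_zero, map_sum] at this
    rw [← this, map_sum, LinearMap.sum_apply]
    refine Finset.sum_congr rfl fun j hj => ?_
    rw [map_smul, hq j hj]
    simp
  have hp0 : p = 0 := by
    by_contra hp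
    have hinj := ((Module.End.isUnit_iff _).1 (isUnit_aeval_of_forall_isUnit φ h hp)).1
    exact hv (hinj (by rw [hpv, map_zero]))
  -- As in Lagrange interpolation, evaluation at `i` kills every summand of `p` except the one with
  -- coefficient `m i`.
  have hev := congrArg (Polynomial.eval i) hp0
  simp only [p, q, eval_finsetSum, eval_mul, eval_C, eval_prod, eval_sub, eval_X, eval_zero] at hev
  rw [Finset.sum_eq_single_of_mem i hi] at hev
  · refine (mul_eq_zero.1 hev).resolve_right (Finset.prod_ne_zero_iff.2 fun j hj => ?_)
    exact sub_ne_zero.2 (Finset.ne_of_mem_erase hj).symm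
  · intro j hj hji
    rw [Finset.prod_eq_zero (i := i) (Finset.mem_erase.2 ⟨hji.symm, hi⟩) (sub_self i), mul_zero]

/-- An operator on a nonzero complex vector space of countable dimension has nonempty spectrum. -/
theorem exists_not_isUnit_sub_of_rank_le {V : Type*} [AddCommGroup V] [Module ℂ V] [Nontrivial V]
    (hV : Module.rank ℂ V ≤ Cardinal.aleph0) (φ : Module.End ℂ V) :
    ∃ μ : ℂ, ¬ IsUnit (φ - algebraMap ℂ _ μ) := by
  by_contra! h
  obtain ⟨v, hv⟩ := exists_ne (0 : V)
  choose u hu using fun μ => ((Module.End.isUnit_iff _).1 (h μ)).2 v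
  -- With empty spectrum the resolvents of `φ` at `v` would be continuum many independent vectors.
  have := (linearIndependent_of_forall_sub_apply_eq φ h hv u hu).cardinal_lift_le_rank
  rw [Cardinal.mk_complex, Cardinal.lift_continuum] at this
  have h2 := this.trans (Cardinal.lift_le_aleph0.2 hV)
  exact absurd h2 (not_le.2 Cardinal.aleph0_lt_continuum)

/-- All nontrivial isomorphisms below come from this: a homomorphism out of a model, checked to be
nonzero on one vector, needs no explicit inverse. -/
theorem nonempty_equiv_of_hom {R V V' : Type*} [Ring R] [AddCommGroup V] [Module R V]
    [AddCommGroup V'] [Module R V'] [IsSimpleModule R V] [IsSimpleModule R V']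
    (φ : V →ₗ[R] V') {v : V} (hv : φ v ≠ 0) : Nonempty (V ≃ₗ[R] V') := by
  have h : φ ≠ 0 := by
    rintro rfl
    exact hv rfl
  exact ⟨LinearEquiv.ofBijective φ (LinearMap.bijective_of_ne_zero h)⟩

/-! ### The action of the generators on a module -/

section Action

variable {f : ℂ[X]} {V : Type*} [AddCommGroup V] [Module ℂ V] [Module (H f) V]
  [IsScalarTower ℂ (H f) V] {V' : Type*} [AddCommGroup V'] [Module ℂ V'] [Module (H f) V']
  [IsScalarTower ℂ (H f) V']

theorem H.induction {p : H f → Prop} (hs : ∀ r, p (algebraMap ℂ _ r)) (hg : ∀ g, p (H.gen f g))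
    (hm : ∀ a b, p a → p b → p (a * b)) (ha : ∀ a b, p a → p b → p (a + b)) (u : H f) : p u := by
  obtain ⟨q, rfl⟩ : ∃ q, H.mk f q = u := RingQuot.mkAlgHom_surjective ℂ (Rel f) u
  induction q using FreeAlgebra.induction with
  | grade0 r =>
    rw [AlgHom.commutes]
    exact hs r
  | grade1 g => exact hg g
  | mul a b h1 h2 =>
    rw [map_mul]
    exact hm _ _ h1 h2
  | add a b h1 h2 =>
    rw [map_add]
    exact ha _ _ h1 h2

/-- The words in three letters are countably many and span. -/
theorem H.rank_le_aleph0 : Module.rank ℂ (H f) ≤ Cardinal.aleph0 := by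
  have h := LinearMap.lift_rank_le_of_surjective (H.mk f).toLinearMap
    (RingQuot.mkAlgHom_surjective ℂ (Rel f))
  rw [Cardinal.lift_id, Cardinal.lift_id, FreeAlgebra.rank_eq, Cardinal.lift_id] at h
  have : Finite Gen := by
    classical
    exact @Finite.of_fintype Gen ⟨{Gen.x, Gen.h, Gen.y}, fun g => by cases g <;> simp⟩
  exact h.trans Cardinal.mk_le_aleph0

variable (f V) in
/-- The operator by which a generator of `𝓗(f)` acts on a module. -/
def act (g : Gen) : Module.End ℂ V := Algebra.lsmul ℂ ℂ V (H.gen f g)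

theorem rank_le_aleph0_of_isSimpleModule [IsSimpleModule (H f) V] :
    Module.rank ℂ V ≤ Cardinal.aleph0 := by
  have := IsSimpleModule.nontrivial (H f) V
  obtain ⟨v, hv⟩ := exists_ne (0 : V)
  have h := LinearMap.lift_rank_le_of_surjective
    ((LinearMap.toSpanSingleton (H f) V v).restrictScalars ℂ)
    (IsSimpleModule.toSpanSingleton_surjective (H f) hv)
  exact Cardinal.lift_le_aleph0.1 (h.trans (Cardinal.lift_le_aleph0.2 H.rank_le_aleph0))

/-- A `ℂ`-linear map that commutes with the generators is `𝓗(f)`-linear. -/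
def homOfCommute (φ : V →ₗ[ℂ] V') (h : ∀ g v, φ (act f V g v) = act f V' g (φ v)) :
    V →ₗ[H f] V' where
  toFun := φ
  map_add' := map_add φ
  map_smul' := by
    intro u v
    rw [RingHom.id_apply]
    induction u using H.induction generalizing v with
    | hs r => rw [algebraMap_smul, algebraMap_smul, map_smul]
    | hg g => exact h g v
    | hm a b h1 h2 => rw [mul_smul, h1, h2, mul_smul]
    | ha a b h1 h2 => rw [add_smul, map_add, h1, h2, add_smul]

/-- Schur's lemma for irreducible modules over `𝓗(f)`. -/
theorem exists_eq_smul_of_commute [IsSimpleModule (H f) V] (φ : Module.End ℂ V)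
    (h : ∀ g, φ * act f V g = act f V g * φ) : ∃ s : ℂ, φ = s • 1 := by
  have := IsSimpleModule.nontrivial (H f) V
  obtain ⟨s, hs⟩ := exists_not_isUnit_sub_of_rank_le
    (rank_le_aleph0_of_isSimpleModule (f := f) (V := V)) φ
  let ψ : V →ₗ[H f] V := homOfCommute (φ - algebraMap ℂ _ s) fun g v => by
    have := LinearMap.congr_fun (h g) v
    simp only [Module.End.mul_apply] at this
    simp [this]
  refine ⟨s, ?_⟩
  -- `φ - s` is an endomorphism of a simple module; it is not invertible by the choice of `s`, so it
  -- vanishes.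
  rcases LinearMap.bijective_or_eq_zero ψ with hψ | hψ
  · exact absurd ((Module.End.isUnit_iff (φ - algebraMap ℂ _ s)).2 hψ) hs
  · ext v
    have : (φ - algebraMap ℂ _ s) v = 0 := LinearMap.congr_fun hψ v
    simpa [sub_eq_zero] using this

theorem H.gen_hx : H.gen f .h * H.gen f .x = H.gen f .x * aeval (H.gen f .h) f := by
  have := RingQuot.mkAlgHom_rel ℂ (Rel.hx (f := f))
  rw [map_mul, map_mul, ← aeval_algHom_apply] at this
  exact this

theorem H.gen_yh : H.gen f .y * H.gen f .h = aeval (H.gen f .h) f * H.gen f .y := by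
  have := RingQuot.mkAlgHom_rel ℂ (Rel.yh (f := f))
  rw [map_mul, map_mul, ← aeval_algHom_apply] at this
  exact this

theorem H.gen_yx : H.gen f .y * H.gen f .x - H.gen f .x * H.gen f .y =
    aeval (H.gen f .h) f - H.gen f .h := by
  have := RingQuot.mkAlgHom_rel ℂ (Rel.yx (f := f))
  rw [map_sub, map_sub, map_mul, map_mul, ← aeval_algHom_apply] at this
  exact this

theorem act_hx : act f V .h * act f V .x = act f V .x * aeval (act f V .h) f := by
  simp only [act, aeval_algHom_apply, ← map_mul, H.gen_hx]

theorem act_yh : act f V .y * act f V .h = aeval (act f V .h) f * act f V .y := by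
  simp only [act, aeval_algHom_apply, ← map_mul, H.gen_yh]

theorem act_yx : act f V .y * act f V .x - act f V .x * act f V .y =
    aeval (act f V .h) f - act f V .h := by
  simp only [act, aeval_algHom_apply, ← map_mul, ← map_sub, H.gen_yx]

theorem equiv_act (φ : V ≃ₗ[H f] V') (g : Gen) (v : V) :
    φ (act f V g v) = act f V' g (φ v) := map_smul φ _ v

end Action

/-! ### Operators that commute up to a scalar -/

section QCommute

variable {A : Type*} [Ring A] [Algebra ℂ A] {w : ℂ}

theorem mul_pow_of_qcommute {P Q : A} (h : P * Q = w • (Q * P)) (k : ℕ) :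
    P * Q ^ k = w ^ k • (Q ^ k * P) := by
  induction k with
  | zero => simp
  | succ k ih =>
    rw [pow_succ, ← mul_assoc, ih, smul_mul_assoc, mul_assoc, h, mul_smul_comm, smul_smul,
      mul_assoc, pow_succ]

theorem pow_mul_of_qcommute {P Q : A} (h : P * Q = w • (Q * P)) (k : ℕ) :
    P ^ k * Q = w ^ k • (Q * P ^ k) := by
  induction k with
  | zero => simp
  | succ k ih =>
    rw [pow_succ', mul_assoc, ih, mul_smul_comm, ← mul_assoc, h, smul_mul_assoc, smul_smul,
      mul_assoc, pow_succ]

/-- Negative powers are needed because the bases of `A'` and `B'` are indexed by all integers. -/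
theorem mul_zpow_of_qcommute (hw : w ≠ 0) {P : A} {Q : Aˣ} (h : P * Q = w • (Q * P)) (k : ℤ) :
    P * (Q ^ k : Aˣ) = w ^ k • ((Q ^ k : Aˣ) * P) := by
  have hinv : P * (Q⁻¹ : Aˣ) = w⁻¹ • ((Q⁻¹ : Aˣ) * P) := by
    rw [eq_inv_smul_iff₀ hw]
    calc w • (P * (Q⁻¹ : Aˣ)) = (Q⁻¹ : Aˣ) * (w • (Q * P)) * (Q⁻¹ : Aˣ) := by
          rw [mul_smul_comm, Units.inv_mul_cancel_left, smul_mul_assoc]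
      _ = (Q⁻¹ : Aˣ) * P := by rw [← h, mul_assoc, Units.mul_inv_cancel_right]
  obtain ⟨k, rfl | rfl⟩ := k.eq_nat_or_neg
  · simpa using mul_pow_of_qcommute h k
  · simpa using mul_pow_of_qcommute hinv k

/-- Moving `Y` through the factors one at a time produces corrections `(w - 1) w ^ i`, whose
geometric sum is `w ^ (k + 1) - 1`. It vanishes at exponent `n`, which makes `X ^ n` central, and at
no smaller positive exponent, which makes `C` irreducible. -/
theorem mul_pow_succ_of_commutator {X U Y : A} (hUX : U * X = w • (X * U))
    (hYX : Y * X = X * Y + (w - 1) • U) (k : ℕ) :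
    Y * X ^ (k + 1) = X ^ (k + 1) * Y + (w ^ (k + 1) - 1) • (X ^ k * U) := by
  induction k with
  | zero => simpa using hYX
  | succ k ih =>
    rw [pow_succ X (k + 1), ← mul_assoc, ih, add_mul, mul_assoc _ Y, hYX, smul_mul_assoc,
      mul_assoc (X ^ k), hUX, mul_add, mul_smul_comm, mul_smul_comm, ← mul_assoc (X ^ k),
      ← pow_succ, ← mul_assoc, ← pow_succ, smul_smul, add_assoc, ← add_smul]
    ring_nf

theorem pow_succ_mul_of_commutator {X U Y : A} (hYU : Y * U = w • (U * Y))
    (hYX : Y * X = X * Y + (w - 1) • U) (k : ℕ) :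
    Y ^ (k + 1) * X = X * Y ^ (k + 1) + (w ^ (k + 1) - 1) • (U * Y ^ k) := by
  induction k with
  | zero => simpa using hYX
  | succ k ih =>
    rw [pow_succ' Y (k + 1), mul_assoc, ih, mul_add, ← mul_assoc Y X, hYX, mul_smul_comm,
      ← mul_assoc Y U, hYU, add_mul, smul_mul_assoc, smul_mul_assoc, mul_assoc U,
      ← pow_succ', mul_assoc, ← pow_succ', smul_smul, add_assoc, ← add_smul]
    ring_nf

end QCommute

/-! ### Eigenvectors -/

/-- An operator annihilated by a nonzero polynomial has an eigenvector in every nonzero stable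
subspace. -/
theorem exists_eigenvector_mem {V : Type*} [AddCommGroup V] [Module ℂ V] {φ : Module.End ℂ V}
    {p : ℂ[X]} (hp : p ≠ 0) (hφ : aeval φ p = 0) {K : Submodule ℂ V} (hK : ∀ v ∈ K, φ v ∈ K)
    {v : V} (hv : v ∈ K) (hv0 : v ≠ 0) : ∃ β : ℂ, ∃ u ∈ K, u ≠ 0 ∧ φ u = β • u := by
  -- Peel off one root at a time: either `φ v - r • v` vanishes and `v` is an eigenvector, or it is
  -- a nonzero vector of `K` killed by the shorter product.
  have key : ∀ (s : Multiset ℂ) (v : V), v ∈ K → v ≠ 0 →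
      aeval φ (s.map fun r => X - Polynomial.C r).prod v = 0 →
      ∃ β : ℂ, ∃ u ∈ K, u ≠ 0 ∧ φ u = β • u := by
    intro s
    induction s using Multiset.induction_on with
    | empty =>
      intro v _ hv0 h
      exact absurd (by simpa using h) hv0
    | cons r s ih =>
      intro v hv hv0 h
      rw [Multiset.map_cons, Multiset.prod_cons, mul_comm, map_mul, Module.End.mul_apply] at h
      have hr : aeval φ (X - Polynomial.C r) v = φ v - r • v := by simp
      rw [hr] at h
      by_cases h0 : φ v - r • v = 0
      · exact ⟨r, v, hv, hv0, sub_eq_zero.1 h0⟩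
      · exact ih _ (K.sub_mem (hK v hv) (K.smul_mem r hv)) h0 h
  refine key p.roots v hv hv0 ?_
  have h := LinearMap.congr_fun hφ v
  rw [(IsAlgClosed.splits p).eq_prod_roots, map_mul, aeval_C, Module.End.mul_apply,
    Module.algebraMap_end_apply, LinearMap.zero_apply] at h
  exact (smul_eq_zero.1 h).resolve_left (leadingCoeff_ne_zero.2 hp)

theorem exists_eigenvector_mem_of_pow_eq_smul {V : Type*} [AddCommGroup V] [Module ℂ V]
    {φ : Module.End ℂ V} {n : ℕ} (hn : 1 < n) {s : ℂ} (hφ : φ ^ n = s • 1) {K : Submodule ℂ V}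
    (hK : ∀ v ∈ K, φ v ∈ K) {v : V} (hv : v ∈ K) (hv0 : v ≠ 0) :
    ∃ β : ℂ, ∃ u ∈ K, u ≠ 0 ∧ φ u = β • u := by
  refine exists_eigenvector_mem (X_pow_sub_C_ne_zero (by omega : 0 < n) s) ?_ hK hv hv0
  simp [hφ, Algebra.smul_def]

theorem pow_apply_eigen {V : Type*} [AddCommGroup V] [Module ℂ V] {φ : Module.End ℂ V} {β : ℂ}
    {v : V} (hv : φ v = β • v) (k : ℕ) : (φ ^ k) v = β ^ k • v := by
  induction k with
  | zero => simp
  | succ k ih => rw [pow_succ, Module.End.mul_apply, hv, map_smul, ih, smul_smul, pow_succ']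

theorem eigenvalue_pow_eq {V : Type*} [AddCommGroup V] [Module ℂ V] {φ : Module.End ℂ V} {n : ℕ}
    {s β : ℂ} (hφ : φ ^ n = s • 1) {v : V} (hv0 : v ≠ 0) (hv : φ v = β • v) : β ^ n = s := by
  have h := pow_apply_eigen hv n
  rw [hφ, LinearMap.smul_apply, Module.End.one_apply] at h
  exact (smul_left_injective ℂ hv0 h).symm

theorem injective_of_pow_eq_smul {V : Type*} [AddCommGroup V] [Module ℂ V] {φ : Module.End ℂ V}
    {n : ℕ} (hn : 1 < n) {a : ℂ} (ha : a ≠ 0) (h : φ ^ n = a • 1) {v : V} (hv : φ v = 0) :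
    v = 0 := by
  have h1 := LinearMap.congr_fun h v
  obtain ⟨m, rfl⟩ : ∃ m, n = m + 1 := ⟨n - 1, by omega⟩
  rw [pow_succ, Module.End.mul_apply, hv, map_zero, LinearMap.smul_apply, Module.End.one_apply,
    eq_comm] at h1
  exact (smul_eq_zero.1 h1).resolve_left ha

/-- Take the last nonzero vector among `v`, `φ v`, `φ² v`, ...; the predicate `p` serves to keep it
inside a given submodule. -/
theorem exists_ker_of_pow_eq_zero {V : Type*} [AddCommGroup V] [Module ℂ V] {φ : Module.End ℂ V}
    {n : ℕ} (h : φ ^ n = 0) {p : V → Prop} (hp : ∀ v, p v → p (φ v)) {v : V} (hv : p v)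
    (hv0 : v ≠ 0) : ∃ u, p u ∧ u ≠ 0 ∧ φ u = 0 := by
  replace h := LinearMap.congr_fun h v
  rw [LinearMap.zero_apply] at h
  induction n generalizing v with
  | zero => exact absurd (by simpa using h) hv0
  | succ n ih =>
    by_cases h0 : φ v = 0
    · exact ⟨v, hv, hv0, h0⟩
    · exact ih (hp v hv) h0 (by rwa [pow_succ, Module.End.mul_apply] at h)

theorem linearIndependent_of_eigen_geom {V : Type*} [AddCommGroup V] [Module ℂ V] {n : ℕ} {w : ℂ}
    (hw : IsPrimitiveRoot w n) {φ : Module.End ℂ V} {β : ℂ} (hβ : β ≠ 0) {v : ℕ → V}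
    (hv0 : ∀ i < n, v i ≠ 0) (hv : ∀ i < n, φ (v i) = (β * w ^ i) • v i) :
    LinearIndependent ℂ fun i : Fin n => v i := by
  refine Module.End.eigenvectors_linearIndependent' φ (fun i : Fin n => β * w ^ (i : ℕ)) ?_ _
    fun i => ⟨Module.End.mem_eigenspace_iff.2 (hv i i.2), hv0 i i.2⟩
  intro i j hij
  exact Fin.ext (hw.pow_inj i.2 j.2 (mul_left_cancel₀ hβ hij))

theorem isSimpleModule_of_forall_eq_top {R V : Type*} [Ring R] [AddCommGroup V] [Module R V]
    [Module ℂ V] {n : ℕ} (hn : 0 < n) (hV : Module.finrank ℂ V = n)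
    (h : ∀ W : Submodule R V, ∀ v ∈ W, v ≠ 0 → W = ⊤) : IsSimpleModule R V := by
  have : Nontrivial V := Module.nontrivial_of_finrank_pos (R := ℂ) (by omega)
  rw [isSimpleModule_iff]
  exact {
    eq_bot_or_eq_top := fun W => by
      refine or_iff_not_imp_left.2 fun hW => ?_
      obtain ⟨v, hv, hv0⟩ := W.exists_mem_ne_zero_of_ne_bot hW
      exact h W v hv hv0 }

/-! ### Modules over `𝓗(w h + c)` -/

section Lin

variable {n : ℕ} (hn : 1 < n) {w : ℂ} (hw : IsPrimitiveRoot w n) {c : ℂ}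
  {V : Type*} [AddCommGroup V] [Module ℂ V] [Module (H (lin w c)) V]
  [IsScalarTower ℂ (H (lin w c)) V]

variable (w c V) in
/-- The operator of `x`. -/
abbrev opX : Module.End ℂ V := act (lin w c) V .x

variable (w c V) in
/-- The operator of `y`. -/
abbrev opY : Module.End ℂ V := act (lin w c) V .y

variable (w c V) in
/-- The operator of `h - e`, where `e` is the fixed point of `w h + c`. -/
def opU : Module.End ℂ V := act (lin w c) V .h - fixedPt w c • 1

variable (w c V) in
/-- The operator of the central element `x y - h`. -/
def opZ : Module.End ℂ V := opX w c V * opY w c V - act (lin w c) V .h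

theorem act_h_eq : act (lin w c) V .h = opU w c V + fixedPt w c • 1 := by
  rw [opU, sub_add_cancel]

include hn hw

/-- This is `f(e + u) = e + w u`, which turns the defining relations into commutation up to the
scalar `w`. -/
theorem aeval_act_h : aeval (act (lin w c) V .h) (lin w c) = w • opU w c V + fixedPt w c • 1 := by
  have h1 : 1 - w ≠ 0 := sub_ne_zero.2 (hw.ne_one hn).symm
  have h2 : c = (1 - w) * fixedPt w c := by
    rw [fixedPt]
    field_simp
  simp only [lin, map_add, map_mul, aeval_C, aeval_X, Algebra.algebraMap_eq_smul_one,
    smul_mul_assoc, one_mul, opU, smul_sub, smul_smul]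
  nth_rw 2 [h2]
  rw [sub_mul, one_mul, sub_smul]
  abel

theorem opU_mul_opX : opU w c V * opX w c V = w • (opX w c V * opU w c V) := by
  have h := act_hx (f := lin w c) (V := V)
  rw [aeval_act_h hn hw, act_h_eq, add_mul, mul_add, smul_mul_assoc, one_mul, mul_smul_comm _ _ 1,
    mul_one, mul_smul_comm] at h
  exact add_right_cancel h

theorem opY_mul_opU : opY w c V * opU w c V = w • (opU w c V * opY w c V) := by
  have h := act_yh (f := lin w c) (V := V)
  rw [aeval_act_h hn hw, act_h_eq, add_mul, mul_add, smul_mul_assoc _ 1, one_mul,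
    mul_smul_comm _ _ 1, mul_one, smul_mul_assoc] at h
  exact add_right_cancel h

theorem opY_mul_opX :
    opY w c V * opX w c V = opX w c V * opY w c V + (w - 1) • opU w c V := by
  have h := act_yx (f := lin w c) (V := V)
  rw [aeval_act_h hn hw, act_h_eq, add_sub_add_right_eq_sub] at h
  rw [sub_smul, one_smul, ← h]
  abel

theorem opY_mul_opX_eq :
    opY w c V * opX w c V = opZ w c V + w • opU w c V + fixedPt w c • 1 := by
  rw [opY_mul_opX hn hw, opZ, act_h_eq, sub_smul, one_smul]
  abel

omit hn hw in
theorem commute_act_of_commute {φ : Module.End ℂ V} (hx : φ * opX w c V = opX w c V * φ)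
    (hu : φ * opU w c V = opU w c V * φ) (hy : φ * opY w c V = opY w c V * φ) (g : Gen) :
    φ * act (lin w c) V g = act (lin w c) V g * φ := by
  cases g with
  | x => exact hx
  | h => rw [act_h_eq, mul_add, add_mul, hu, mul_smul_comm, smul_mul_assoc, mul_one, one_mul]
  | y => exact hy

/-- Both the factor `w ^ n` met when passing `U` and the correction `w ^ n - 1` met when passing `y`
become trivial. -/
theorem opX_pow_commute (g : Gen) :
    opX w c V ^ n * act (lin w c) V g = act (lin w c) V g * opX w c V ^ n := by
  refine commute_act_of_commute (Commute.pow_self _ _) ?_ ?_ g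
  · rw [mul_pow_of_qcommute (opU_mul_opX hn hw), hw.pow_eq_one, one_smul]
  · obtain ⟨m, rfl⟩ : ∃ m, n = m + 1 := ⟨n - 1, by omega⟩
    rw [mul_pow_succ_of_commutator (opU_mul_opX hn hw) (opY_mul_opX hn hw), hw.pow_eq_one,
      sub_self, zero_smul, add_zero]

theorem opY_pow_commute (g : Gen) :
    opY w c V ^ n * act (lin w c) V g = act (lin w c) V g * opY w c V ^ n := by
  refine commute_act_of_commute ?_ ?_ (Commute.pow_self _ _) g
  · obtain ⟨m, rfl⟩ : ∃ m, n = m + 1 := ⟨n - 1, by omega⟩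
    rw [pow_succ_mul_of_commutator (opY_mul_opU hn hw) (opY_mul_opX hn hw), hw.pow_eq_one,
      sub_self, zero_smul, add_zero]
  · rw [pow_mul_of_qcommute (opY_mul_opU hn hw), hw.pow_eq_one, one_smul]

theorem opU_pow_commute (g : Gen) :
    opU w c V ^ n * act (lin w c) V g = act (lin w c) V g * opU w c V ^ n := by
  refine commute_act_of_commute ?_ (Commute.pow_self _ _) ?_ g
  · rw [pow_mul_of_qcommute (opU_mul_opX hn hw), hw.pow_eq_one, one_smul]
  · rw [mul_pow_of_qcommute (opY_mul_opU hn hw), hw.pow_eq_one, one_smul]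

/-- The term `(w - 1) x U` from exchanging `y` and `x` compensates the factor `w` from exchanging
`U` and `x`; likewise for `y`. -/
theorem opZ_commute (g : Gen) :
    opZ w c V * act (lin w c) V g = act (lin w c) V g * opZ w c V := by
  have hX := opU_mul_opX hn hw (c := c) (V := V)
  have hY := opY_mul_opU hn hw (c := c) (V := V)
  have hYX := opY_mul_opX hn hw (c := c) (V := V)
  refine commute_act_of_commute ?_ ?_ ?_ g
  · simp only [opZ, act_h_eq, sub_mul, mul_sub, add_mul, mul_add, mul_assoc, hYX, hX, sub_smul,
      one_smul, smul_mul_assoc, mul_smul_comm, one_mul, mul_one]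
    abel
  · simp only [opZ, act_h_eq, sub_mul, mul_sub, add_mul, mul_add, mul_assoc, hY,
      smul_mul_assoc, mul_smul_comm, one_mul, mul_one]
    rw [← mul_assoc (opU w c V), hX, smul_mul_assoc, mul_assoc]
  · simp only [opZ, act_h_eq, sub_mul, mul_sub, add_mul, mul_add,
      smul_mul_assoc, mul_smul_comm, one_mul, mul_one]
    rw [← mul_assoc (opY w c V), hYX, hY, add_mul, smul_mul_assoc, sub_smul, one_smul]
    abel

/-! ### Irreducibility criteria -/

omit hw in
-- Eigenvectors with distinct eigenvalues are independent, and there are `n` of them in dimension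
-- `n`. The root `ω` is separate from `w` because powers of `x` scale eigenvalues by `w`, powers of
-- `y` by `w⁻¹`.
theorem eq_top_of_eigen_geom {ω : ℂ} (hω : IsPrimitiveRoot ω n) (hV : Module.finrank ℂ V = n) {β : ℂ} (hβ : β ≠ 0) {v : ℕ → V}
    (hv0 : ∀ i < n, v i ≠ 0) (hv : ∀ i < n, opU w c V (v i) = (β * ω ^ i) • v i)
    {W : Submodule (H (lin w c)) V} (hW : ∀ i, v i ∈ W) : W = ⊤ := by
  have : Nonempty (Fin n) := ⟨⟨0, by omega⟩⟩
  have hspan := (linearIndependent_of_eigen_geom hω hβ hv0 hv).span_eq_top_of_card_eq_finrank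
    (by rw [Fintype.card_fin, hV])
  have hle : ⊤ ≤ W.restrictScalars ℂ := by
    rw [← hspan, Submodule.span_le]
    rintro _ ⟨i, rfl⟩
    exact hW i
  exact eq_top_iff.2 fun v _ => hle (Submodule.mem_top (x := v))

omit hn hw in
theorem act_mem (W : Submodule (H (lin w c)) V) (g : Gen) {v : V} (hv : v ∈ W) :
    act (lin w c) V g v ∈ W := W.smul_mem _ hv

omit hn hw in
theorem opU_mem (W : Submodule (H (lin w c)) V) {v : V} (hv : v ∈ W) : opU w c V v ∈ W :=
  W.sub_mem (act_mem W .h hv) (W.smul_of_tower_mem _ hv)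

omit hn hw in
theorem act_pow_mem (W : Submodule (H (lin w c)) V) (g : Gen) {v : V} (hv : v ∈ W) (i : ℕ) :
    (act (lin w c) V g ^ i) v ∈ W := by
  induction i with
  | zero => simpa using hv
  | succ i ih =>
    rw [pow_succ', Module.End.mul_apply]
    exact act_mem W g ih

theorem opU_opX_pow {β : ℂ} {v : V} (hv : opU w c V v = β • v) (i : ℕ) :
    opU w c V ((opX w c V ^ i) v) = (β * w ^ i) • (opX w c V ^ i) v := by
  have := LinearMap.congr_fun (mul_pow_of_qcommute (opU_mul_opX hn hw (c := c) (V := V)) i) v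
  simp only [Module.End.mul_apply, LinearMap.smul_apply] at this
  rw [this, hv, map_smul, smul_smul, mul_comm]

theorem opU_opY_pow {β : ℂ} {v : V} (hv : opU w c V v = β • v) (i : ℕ) :
    opU w c V ((opY w c V ^ i) v) = (β * w⁻¹ ^ i) • (opY w c V ^ i) v := by
  have := LinearMap.congr_fun (pow_mul_of_qcommute (opY_mul_opU hn hw (c := c) (V := V)) i) v
  simp only [Module.End.mul_apply, LinearMap.smul_apply] at this
  rw [hv, map_smul] at this
  have hwi : w ^ i ≠ 0 := pow_ne_zero i (hw.ne_zero (by omega))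
  rw [mul_comm, mul_smul, this, smul_smul, inv_pow, inv_mul_cancel₀ hwi, one_smul]

/-- A nonzero submodule contains a `U`-eigenvector `u`; as `x` is injective, the vectors `x ^ i u`
with `i < n` are nonzero eigenvectors and span everything. -/
theorem isSimpleModule_of_opX (hV : Module.finrank ℂ V = n) {s a : ℂ} (hs : s ≠ 0) (ha : a ≠ 0)
    (hU : opU w c V ^ n = s • 1) (hX : opX w c V ^ n = a • 1) :
    IsSimpleModule (H (lin w c)) V := by
  refine isSimpleModule_of_forall_eq_top (by omega) hV fun W v hv hv0 => ?_
  obtain ⟨β, u, hu, hu0, hβ⟩ := exists_eigenvector_mem_of_pow_eq_smul hn hU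
    (K := W.restrictScalars ℂ) (fun v hv => opU_mem W hv) hv hv0
  have hβ0 : β ≠ 0 := by
    rintro rfl
    exact hs (by rw [← eigenvalue_pow_eq hU hu0 hβ, zero_pow (by omega)])
  refine eq_top_of_eigen_geom hn hw hV hβ0 (v := fun i => (opX w c V ^ i) u) (fun i _ => ?_)
    (fun i _ => opU_opX_pow hn hw hβ i) fun i => act_pow_mem W .x hu i
  induction i with
  | zero => simpa using hu0
  | succ i ih =>
    rw [pow_succ', Module.End.mul_apply]
    exact fun h => ih (by omega) (injective_of_pow_eq_smul hn ha hX h)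

theorem isSimpleModule_of_opY (hV : Module.finrank ℂ V = n) {s a : ℂ} (hs : s ≠ 0) (ha : a ≠ 0)
    (hU : opU w c V ^ n = s • 1) (hY : opY w c V ^ n = a • 1) :
    IsSimpleModule (H (lin w c)) V := by
  refine isSimpleModule_of_forall_eq_top (by omega) hV fun W v hv hv0 => ?_
  obtain ⟨β, u, hu, hu0, hβ⟩ := exists_eigenvector_mem_of_pow_eq_smul hn hU
    (K := W.restrictScalars ℂ) (fun v hv => opU_mem W hv) hv hv0
  have hβ0 : β ≠ 0 := by
    rintro rfl
    exact hs (by rw [← eigenvalue_pow_eq hU hu0 hβ, zero_pow (by omega)])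
  refine eq_top_of_eigen_geom hn hw.inv hV hβ0 (v := fun i => (opY w c V ^ i) u) (fun i _ => ?_)
    (fun i _ => opU_opY_pow hn hw hβ i) fun i => act_pow_mem W .y hu i
  induction i with
  | zero => simpa using hu0
  | succ i ih =>
    rw [pow_succ', Module.End.mul_apply]
    exact fun h => ih (by omega) (injective_of_pow_eq_smul hn ha hY h)

/-- Here injectivity of `x` is not available. For an eigenvector `u` in `ker y`, the identity `y x ^
(i + 1) u = (w ^ (i + 1) - 1) β x ^ i u` shows instead that `x ^ i u ≠ 0` for `i < n`. -/
theorem isSimpleModule_of_opY_pow_eq_zero (hV : Module.finrank ℂ V = n) {s : ℂ} (hs : s ≠ 0)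
    (hU : opU w c V ^ n = s • 1) (hY : opY w c V ^ n = 0) :
    IsSimpleModule (H (lin w c)) V := by
  refine isSimpleModule_of_forall_eq_top (by omega) hV fun W v hv hv0 => ?_
  obtain ⟨v', hv', hv'0, hv'Y⟩ := exists_ker_of_pow_eq_zero hY (p := fun v => v ∈ W)
    (fun v hv => act_mem W .y hv) hv hv0
  obtain ⟨β, u, ⟨hu, huY⟩, hu0, hβ⟩ := exists_eigenvector_mem_of_pow_eq_smul hn hU
    (K := W.restrictScalars ℂ ⊓ LinearMap.ker (opY w c V)) (fun v hv => ⟨opU_mem W hv.1, by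
      have := LinearMap.congr_fun (opY_mul_opU hn hw (c := c) (V := V)) v
      simp only [Module.End.mul_apply, LinearMap.smul_apply] at this
      exact this.trans (by rw [LinearMap.mem_ker.1 hv.2, map_zero, smul_zero])⟩)
    ⟨hv', hv'Y⟩ hv'0
  have hβ0 : β ≠ 0 := by
    rintro rfl
    exact hs (by rw [← eigenvalue_pow_eq hU hu0 hβ, zero_pow (by omega)])
  refine eq_top_of_eigen_geom hn hw hV hβ0 (v := fun i => (opX w c V ^ i) u) (fun i hi => ?_)
    (fun i _ => opU_opX_pow hn hw hβ i) fun i => act_pow_mem W .x hu i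
  induction i with
  | zero => simpa using hu0
  | succ i ih =>
    intro h
    have h1 := LinearMap.congr_fun (mul_pow_succ_of_commutator (opU_mul_opX hn hw (c := c) (V := V))
      (opY_mul_opX hn hw) i) u
    simp only [Module.End.mul_apply, LinearMap.add_apply, LinearMap.smul_apply] at h1
    rw [h, LinearMap.mem_ker.1 huY, map_zero, map_zero, zero_add, hβ, map_smul, smul_smul,
      eq_comm] at h1
    -- The exponent `i + 1` lies strictly between `0` and `n`, so `w ^ (i + 1) ≠ 1` by primitivity.
    refine (smul_eq_zero.1 h1).elim (mul_ne_zero (sub_ne_zero.2 fun h2 => ?_) hβ0) (ih (by omega))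
    have := Nat.le_of_dvd (by omega) (hw.dvd_of_pow_eq_one _ h2)
    omega

end Lin

/-! ### Quotients of modules on Laurent polynomials and polynomials -/

theorem Rep.act_of {f : ℂ[X]} {M : Type*} [AddCommGroup M] [Module ℂ M] (R : Rep f M) (g : Gen)
    (v : M) : act f R.Space g (R.of v) = R.of (R.op g v) := R.gen_smul g v

section Quotient

variable {f : ℂ[X]} {M : Type*} [AddCommGroup M] [Module ℂ M] {R : Rep f M}
  (W : Submodule (H f) R.Space)

/-- The class of `v` in a quotient of the module given by three operators. -/
def cls : M →ₗ[ℂ] R.Space ⧸ W := W.mkQ.restrictScalars ℂ ∘ₗ R.of.toLinearMap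

theorem cls_surjective : Function.Surjective (cls W) :=
  W.mkQ_surjective.comp R.of.surjective

theorem cls_eq_zero {v : M} : cls W v = 0 ↔ R.of v ∈ W := Submodule.Quotient.mk_eq_zero W

theorem act_cls (g : Gen) (v : M) : act f (R.Space ⧸ W) g (cls W v) = cls W (R.op g v) := by
  have := congrArg W.mkQ (R.act_of g v)
  exact (map_smul W.mkQ _ _).symm.trans this

theorem exists_hom_cls {V : Type*} [AddCommGroup V] [Module ℂ V] [Module (H f) V]
    [IsScalarTower ℂ (H f) V] (φ : M →ₗ[ℂ] V) (hφ : ∀ g, φ ∘ₗ R.op g = act f V g ∘ₗ φ)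
    (hW : ∀ v, R.of v ∈ W → φ v = 0) :
    ∃ Φ : (R.Space ⧸ W) →ₗ[H f] V, ∀ v, Φ (cls W v) = φ v := by
  let Ψ : R.Space →ₗ[H f] V := homOfCommute (φ ∘ₗ R.of.symm.toLinearMap) fun g v => by
    obtain ⟨v, rfl⟩ := R.of.surjective v
    rw [R.act_of]
    simpa using LinearMap.congr_fun (hφ g) v
  exact ⟨W.liftQ Ψ fun v hv => hW v hv, fun v => W.liftQ_apply Ψ (R.of v)⟩

end Quotient

/-! ### Laurent polynomials modulo `t ^ n - a` -/

section Laurent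

variable {f : ℂ[X]} {R : Rep f ℂ[T;T⁻¹]} (W : Submodule (H f) R.Space) {n : ℕ} {a : ℂ}

theorem laurent_hom_ext {N : Type*} [AddCommGroup N] [Module ℂ N] {φ ψ : ℂ[T;T⁻¹] →ₗ[ℂ] N}
    (h : ∀ i, φ (T i) = ψ (T i)) : φ = ψ :=
  (AddMonoidAlgebra.basis ℤ ℂ).ext fun i => by
    rw [AddMonoidAlgebra.basis_apply]
    exact h i

/-- The linear map on `ℂ[t, t⁻¹]` with prescribed values on the powers of `t`. -/
def laurentLift {N : Type*} [AddCommGroup N] [Module ℂ N] (m : ℤ → N) : ℂ[T;T⁻¹] →ₗ[ℂ] N :=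
  (AddMonoidAlgebra.basis ℤ ℂ).constr ℂ m

theorem laurentLift_T {N : Type*} [AddCommGroup N] [Module ℂ N] (m : ℤ → N) (i : ℤ) :
    laurentLift m (T i) = m i := by
  have := (AddMonoidAlgebra.basis ℤ ℂ).constr_basis ℂ m i
  rwa [AddMonoidAlgebra.basis_apply] at this

theorem cls_T_ext {N : Type*} [AddCommGroup N] [Module ℂ N] {φ ψ : (R.Space ⧸ W) →ₗ[ℂ] N}
    (h : ∀ i, φ (cls W (T i)) = ψ (cls W (T i))) : φ = ψ :=
  LinearMap.cancel_right (cls_surjective W) |>.1 (laurent_hom_ext h)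

/-- Universal property of the models: the ideal of `t ^ n - a` is spanned by the differences `t ^ (i
+ n) - a t ^ i`, so quasi-periodicity of `m` is all that descent requires. -/
theorem exists_hom_cls_T {V : Type*} [AddCommGroup V] [Module ℂ V] [Module (H f) V]
    [IsScalarTower ℂ (H f) V] (hW : ∀ v, R.of v ∈ W ↔ v ∈ cyc n a) (m : ℤ → V)
    (hm : ∀ i, m (i + n) = a • m i) (hR : ∀ g i, laurentLift m (R.op g (T i)) = act f V g (m i)) :
    ∃ Φ : (R.Space ⧸ W) →ₗ[H f] V, ∀ i, Φ (cls W (T i)) = m i := by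
  obtain ⟨Φ, hΦ⟩ := exists_hom_cls W (laurentLift m)
    (fun g => laurent_hom_ext fun i => by simp [hR, laurentLift_T]) fun v hv => by
      obtain ⟨q, rfl⟩ := Ideal.mem_span_singleton'.1 ((hW v).1 hv)
      have : laurentLift m ∘ₗ LinearMap.mulRight ℂ (T (n : ℤ) - LaurentPolynomial.C a) = 0 :=
        laurent_hom_ext fun i => by
          rw [LinearMap.comp_apply, LinearMap.mulRight_apply, mul_sub, ← T_add, mul_comm (T i),
            ← LaurentPolynomial.smul_eq_C_mul, map_sub, map_smul, laurentLift_T, laurentLift_T, hm,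
            sub_self, LinearMap.zero_apply]
      exact LinearMap.congr_fun this q
  exact ⟨Φ, fun i => by rw [hΦ, laurentLift_T]⟩

variable {W}

theorem cls_T_add (hW : ∀ v, R.of v ∈ W ↔ v ∈ cyc n a) (i : ℤ) :
    cls W (T (i + n)) = a • cls W (T i) := by
  rw [← map_smul, ← sub_eq_zero, ← map_sub, cls_eq_zero, hW]
  refine Ideal.mem_span_singleton'.2 ⟨T i, ?_⟩
  rw [mul_sub, ← T_add, mul_comm (T i), LaurentPolynomial.smul_eq_C_mul]

/-- Evaluation at an `n`-th root of `a` kills the ideal but not the unit `t ^ i`. -/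
theorem cls_T_ne_zero (hn : 1 < n) (ha : a ≠ 0) (hW : ∀ v, R.of v ∈ W ↔ v ∈ cyc n a) (i : ℤ) :
    cls W (T i) ≠ 0 := by
  intro h
  rw [cls_eq_zero, hW] at h
  obtain ⟨q, hq⟩ := Ideal.mem_span_singleton'.1 h
  obtain ⟨r, hr⟩ := IsAlgClosed.exists_pow_nat_eq a (by omega : 0 < n)
  have hr0 : r ≠ 0 := by
    rintro rfl
    exact ha (by rw [← hr, zero_pow (by omega)])
  have := congrArg (LaurentPolynomial.eval₂ (RingHom.id ℂ) (Units.mk0 r hr0)) hq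
  simp only [map_mul, map_sub, eval₂_T, LaurentPolynomial.eval₂_C, RingHom.id_apply, zpow_natCast,
    Units.val_pow_eq_pow_val, Units.val_mk0, hr, sub_self, mul_zero] at this
  exact (Units.ne_zero _) this.symm

theorem span_cls_T_eq_top (hn : 1 < n) (ha : a ≠ 0) (hW : ∀ v, R.of v ∈ W ↔ v ∈ cyc n a) :
    ⊤ ≤ Submodule.span ℂ (Set.range fun i : Fin n => cls W (T ((i : ℕ) : ℤ))) := by
  set S := Submodule.span ℂ (Set.range fun i : Fin n => cls W (T ((i : ℕ) : ℤ)))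
  -- A shift by `n` rescales the class by `a ≠ 0`, so membership in `S` depends only on `i` modulo
  -- `n`.
  have hk : ∀ (k : ℕ) (i : ℤ), cls W (T i) ∈ S ↔ cls W (T (i + n * k)) ∈ S := by
    intro k
    induction k with
    | zero => simp
    | succ k ih =>
      intro i
      rw [ih, Nat.cast_succ, mul_add, mul_one, ← add_assoc, cls_T_add hW,
        Submodule.smul_mem_iff _ ha]
  have hmem : ∀ i, cls W (T i) ∈ S := by
    intro i
    have hn0 : (n : ℤ) ≠ 0 := by omega
    have hr : cls W (T (i % n)) ∈ S := by
      refine Submodule.subset_span ⟨⟨(i % n).toNat, ?_⟩, ?_⟩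
      · have := Int.emod_lt_of_pos i (by omega : (0 : ℤ) < n)
        omega
      · simp [Int.toNat_of_nonneg (Int.emod_nonneg i hn0)]
    obtain ⟨k, hk' | hk'⟩ := (i / n).eq_nat_or_neg
    · rw [hk k, ← hk', Int.emod_add_mul_ediv] at hr
      exact hr
    · rw [hk k]
      have := Int.emod_add_mul_ediv i n
      rw [hk'] at this
      rwa [← this, mul_neg, neg_add_cancel_right]
  have : S.mkQ ∘ₗ cls W = 0 := laurent_hom_ext fun i => by
    simpa using hmem i
  intro v _
  obtain ⟨v, rfl⟩ := cls_surjective W v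
  simpa using LinearMap.congr_fun this v

/-- Independence of the `n` spanning classes is read off from the distinct eigenvalues of `φ`, with
no division in the Laurent ring. -/
theorem finrank_laurent (hn : 1 < n) (ha : a ≠ 0) (hW : ∀ v, R.of v ∈ W ↔ v ∈ cyc n a) {w : ℂ}
    (hw : IsPrimitiveRoot w n) {φ : Module.End ℂ (R.Space ⧸ W)} {b : ℂ} (hb : b ≠ 0)
    (hφ : ∀ i, φ (cls W (T i)) = (b * w ^ i) • cls W (T i)) :
    Module.finrank ℂ (R.Space ⧸ W) = n := by
  have hli := linearIndependent_of_eigen_geom hw hb (φ := φ) (v := fun i : ℕ => cls W (T (i : ℤ)))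
    (fun i _ => cls_T_ne_zero hn ha hW i) fun i _ => by rw [hφ, zpow_natCast]
  rw [Module.finrank_eq_card_basis (Module.Basis.mk hli (span_cls_T_eq_top hn ha hW)),
    Fintype.card_fin]

end Laurent

/-! ### Polynomials modulo `t ^ n` -/

section Poly

variable {f : ℂ[X]} {R : Rep f ℂ[X]} (W : Submodule (H f) R.Space) {n : ℕ}

theorem poly_hom_ext {N : Type*} [AddCommGroup N] [Module ℂ N] {φ ψ : ℂ[X] →ₗ[ℂ] N}
    (h : ∀ i, φ (X ^ i) = ψ (X ^ i)) : φ = ψ :=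
  (basisMonomials ℂ).ext fun i => by
    simpa only [coe_basisMonomials, ← X_pow_eq_monomial] using h i

/-- The linear map on `ℂ[t]` with prescribed values on the powers of `t`. -/
def polyLift {N : Type*} [AddCommGroup N] [Module ℂ N] (m : ℕ → N) : ℂ[X] →ₗ[ℂ] N :=
  (basisMonomials ℂ).constr ℂ m

theorem polyLift_X {N : Type*} [AddCommGroup N] [Module ℂ N] (m : ℕ → N) (i : ℕ) :
    polyLift m (X ^ i) = m i := by
  have := (basisMonomials ℂ).constr_basis ℂ m i
  simpa only [polyLift, coe_basisMonomials, ← X_pow_eq_monomial] using this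

theorem cls_X_ext {N : Type*} [AddCommGroup N] [Module ℂ N] {φ ψ : (R.Space ⧸ W) →ₗ[ℂ] N}
    (h : ∀ i, φ (cls W (X ^ i)) = ψ (cls W (X ^ i))) : φ = ψ :=
  LinearMap.cancel_right (cls_surjective W) |>.1 (poly_hom_ext h)

theorem exists_hom_cls_X {V : Type*} [AddCommGroup V] [Module ℂ V] [Module (H f) V]
    [IsScalarTower ℂ (H f) V] (hW : ∀ v, R.of v ∈ W ↔ v ∈ Ideal.span {(X ^ n : ℂ[X])}) (m : ℕ → V)
    (hm : ∀ i, m (i + n) = 0) (hR : ∀ g i, polyLift m (R.op g (X ^ i)) = act f V g (m i)) :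
    ∃ Φ : (R.Space ⧸ W) →ₗ[H f] V, ∀ i, Φ (cls W (X ^ i)) = m i := by
  obtain ⟨Φ, hΦ⟩ := exists_hom_cls W (polyLift m)
    (fun g => poly_hom_ext fun i => by simp [hR, polyLift_X]) fun v hv => by
      obtain ⟨q, rfl⟩ := Ideal.mem_span_singleton'.1 ((hW v).1 hv)
      have : polyLift m ∘ₗ LinearMap.mulRight ℂ (X ^ n) = 0 := poly_hom_ext fun i => by
        simp only [LinearMap.comp_apply, LinearMap.mulRight_apply, ← pow_add, polyLift_X, hm,
          LinearMap.zero_apply]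
      exact LinearMap.congr_fun this q
  exact ⟨Φ, fun i => by rw [hΦ, polyLift_X]⟩

variable {W}

theorem cls_X_eq_zero_iff (hW : ∀ v, R.of v ∈ W ↔ v ∈ Ideal.span {(X ^ n : ℂ[X])}) (i : ℕ) :
    cls W (X ^ i) = 0 ↔ n ≤ i := by
  rw [cls_eq_zero, hW, Ideal.mem_span_singleton, X_pow_dvd_iff]
  refine ⟨fun h => ?_, fun h d hd => ?_⟩
  · by_contra! hi
    simpa using h i hi
  · rw [coeff_X_pow, if_neg (by omega)]

theorem span_cls_X_eq_top (hW : ∀ v, R.of v ∈ W ↔ v ∈ Ideal.span {(X ^ n : ℂ[X])}) :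
    ⊤ ≤ Submodule.span ℂ (Set.range fun i : Fin n => cls W (X ^ (i : ℕ))) := by
  set S := Submodule.span ℂ (Set.range fun i : Fin n => cls W (X ^ (i : ℕ)))
  have : S.mkQ ∘ₗ cls W = 0 := poly_hom_ext fun i => by
    have : cls W (X ^ i) ∈ S := by
      by_cases hi : i < n
      · exact Submodule.subset_span ⟨⟨i, hi⟩, rfl⟩
      · rw [(cls_X_eq_zero_iff hW i).2 (by omega)]
        exact S.zero_mem
    simpa using this
  intro v _
  obtain ⟨v, rfl⟩ := cls_surjective W v
  simpa using LinearMap.congr_fun this v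

theorem finrank_poly (hW : ∀ v, R.of v ∈ W ↔ v ∈ Ideal.span {(X ^ n : ℂ[X])}) {w : ℂ}
    (hw : IsPrimitiveRoot w n) {φ : Module.End ℂ (R.Space ⧸ W)} {b : ℂ} (hb : b ≠ 0)
    (hφ : ∀ i, φ (cls W (X ^ i)) = (b * w ^ i) • cls W (X ^ i)) :
    Module.finrank ℂ (R.Space ⧸ W) = n := by
  have hli := linearIndependent_of_eigen_geom hw hb (φ := φ) (v := fun i : ℕ => cls W (X ^ i))
    (fun i hi => by rwa [Ne, cls_X_eq_zero_iff hW, not_le]) fun i _ => hφ i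
  rw [Module.finrank_eq_card_basis (Module.Basis.mk hli (span_cls_X_eq_top hW)),
    Fintype.card_fin]

end Poly

/-! ### The model modules: central scalars, irreducibility, universal properties -/

section Models

variable {n : ℕ} (hn : 1 < n) {w : ℂ} (hw : IsPrimitiveRoot w n) (c : ℂ)
  {V : Type*} [AddCommGroup V] [Module ℂ V] [Module (H (lin w c)) V]
  [IsScalarTower ℂ (H (lin w c)) V]

include hn hw

omit hn hw in
theorem opZ_apply_eq {z e : ℂ} {v : V} (hh : act (lin w c) V .h v = e • v)
    (hxy : opX w c V (opY w c V v) = (e + z) • v) : opZ w c V v = z • v := by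
  rw [opZ, LinearMap.sub_apply, Module.End.mul_apply, hxy, hh, ← sub_smul, add_sub_cancel_left]

omit hn hw in
theorem opU_apply_eq {β : ℂ} {v : V} (hh : act (lin w c) V .h v = (fixedPt w c + β) • v) :
    opU w c V v = β • v := by
  rw [opU, LinearMap.sub_apply, hh, LinearMap.smul_apply, Module.End.one_apply, ← sub_smul,
    add_sub_cancel_left]

omit hn hw in
theorem act_h_apply_eq {β : ℂ} {v : V} (hu : opU w c V v = β • v) :
    act (lin w c) V .h v = (fixedPt w c + β) • v := by
  rw [act_h_eq, LinearMap.add_apply, hu, LinearMap.smul_apply, Module.End.one_apply, add_smul,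
    add_comm]

/-- Once `Z` is a scalar, `y x` is determined on `U`-eigenvectors; this forces the coefficients in
all the models. -/
theorem opY_opX_apply {z β : ℂ} {v : V} (hZ : opZ w c V = z • 1) (hu : opU w c V v = β • v) :
    opY w c V (opX w c V v) = (fixedPt w c + w * β + z) • v := by
  have := LinearMap.congr_fun (opY_mul_opX_eq hn hw (c := c) (V := V)) v
  simp only [Module.End.mul_apply, LinearMap.add_apply, LinearMap.smul_apply, hZ, hu,
    Module.End.one_apply] at this
  rw [this]
  module

omit hn hw in
theorem opX_opY_apply {z β : ℂ} {v : V} (hZ : opZ w c V = z • 1) (hu : opU w c V v = β • v) :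
    opX w c V (opY w c V v) = (fixedPt w c + β + z) • v := by
  have := LinearMap.congr_fun hZ v
  simp only [opZ, Module.End.mul_apply, LinearMap.sub_apply, LinearMap.smul_apply,
    Module.End.one_apply, act_h_apply_eq c hu] at this
  rw [sub_eq_iff_eq_add.1 this]
  module

/-! ### The modules `A'` -/

section A

variable (b z a : ℂ)

/-- The class of `t ^ i` in `A'`. -/
def aVec (i : ℤ) : AMod hn hw c b z a := cls (subA _ _ z n (orbit_period hn hw c b) a) (T i)

theorem opX_aVec (i : ℤ) : opX w c _ (aVec hn hw c b z a i) = aVec hn hw c b z a (i + 1) := by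
  rw [aVec, act_cls]
  simp [Rep.op, repA, shift_T, aVec]

theorem act_h_aVec (i : ℤ) : act (lin w c) _ .h (aVec hn hw c b z a i) =
    (fixedPt w c + b * w ^ i) • aVec hn hw c b z a i := by
  rw [aVec, act_cls, ← map_smul]
  refine congrArg _ ((shift_T _ _ _).trans ?_)
  rw [add_zero]
  rfl

theorem opU_aVec (i : ℤ) :
    opU w c _ (aVec hn hw c b z a i) = (b * w ^ i) • aVec hn hw c b z a i :=
  opU_apply_eq c (act_h_aVec hn hw c b z a i)

theorem opY_aVec (i : ℤ) : opY w c _ (aVec hn hw c b z a i) =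
    (fixedPt w c + b * w ^ i + z) • aVec hn hw c b z a (i - 1) := by
  rw [aVec, aVec, act_cls, ← map_smul]
  exact congrArg _ (shift_T _ _ _)

theorem aVec_add (i : ℤ) : aVec hn hw c b z a (i + n) = a • aVec hn hw c b z a i :=
  cls_T_add (fun _ => Iff.rfl) i

variable {a} in
theorem aVec_ne_zero (ha : a ≠ 0) (i : ℤ) : aVec hn hw c b z a i ≠ 0 :=
  cls_T_ne_zero hn ha (fun _ => Iff.rfl) i

theorem aMod_opX_pow : opX w c (AMod hn hw c b z a) ^ n = a • 1 := by
  have h : ∀ (k : ℕ) (i : ℤ), (opX w c (AMod hn hw c b z a) ^ k) (aVec hn hw c b z a i) =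
      aVec hn hw c b z a (i + k) := by
    intro k
    induction k with
    | zero => simp
    | succ k ih =>
      intro i
      rw [pow_succ, Module.End.mul_apply, opX_aVec, ih]
      congr 1
      push_cast
      ring
  exact cls_T_ext _ fun i => (h n i).trans (aVec_add hn hw c b z a i)

theorem aMod_opU_pow : opU w c (AMod hn hw c b z a) ^ n = b ^ n • 1 :=
  cls_T_ext _ fun i => (pow_apply_eigen (opU_aVec hn hw c b z a i) n).trans (by
    rw [mul_pow, ← zpow_natCast (w ^ i), zpow_comm, zpow_natCast, hw.pow_eq_one, one_zpow, mul_one]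
    rfl)

theorem aMod_opZ : opZ w c (AMod hn hw c b z a) = z • 1 :=
  cls_T_ext _ fun i => opZ_apply_eq c (act_h_aVec hn hw c b z a i) (by
    have := opY_aVec hn hw c b z a i
    rw [aVec] at this
    rw [this, map_smul, opX_aVec, sub_add_cancel]
    rfl)

variable {a b}

theorem aMod_finrank (hb : b ≠ 0) (ha : a ≠ 0) : Module.finrank ℂ (AMod hn hw c b z a) = n :=
  finrank_laurent hn ha (fun _ => Iff.rfl) hw hb (opU_aVec hn hw c b z a)

theorem aMod_isSimple (hb : b ≠ 0) (ha : a ≠ 0) :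
    IsSimpleModule (H (lin w c)) (AMod hn hw c b z a) :=
  isSimpleModule_of_opX hn hw (aMod_finrank hn hw c z hb ha) (pow_ne_zero n hb) ha
    (aMod_opU_pow hn hw c b z a) (aMod_opX_pow hn hw c b z a)

variable {z}

/-- Since `x ^ n` is a nonzero scalar, `x` is invertible, and `t ^ i ↦ x ^ i v` makes sense for
every integer `i`. -/
theorem exists_hom_aMod (ha : a ≠ 0) (hX : opX w c V ^ n = a • 1) (hZ : opZ w c V = z • 1) {v : V}
    (hv : opU w c V v = b • v) :
    ∃ Φ : AMod hn hw c b z a →ₗ[H (lin w c)] V, Φ (aVec hn hw c b z a 0) = v := by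
  have hw0 : w ≠ 0 := hw.ne_zero (by omega)
  have hunit : IsUnit (opX w c V) := by
    rw [← isUnit_pow_iff (by omega : n ≠ 0), hX, ← Algebra.algebraMap_eq_smul_one]
    exact (isUnit_iff_ne_zero.2 ha).map _
  obtain ⟨P, hP⟩ := hunit
  let m : ℤ → V := fun i => ((P ^ i : (Module.End ℂ V)ˣ) : Module.End ℂ V) v
  have hmX : ∀ i, opX w c V (m i) = m (i + 1) := fun i => by
    simp only [m, add_comm i 1, zpow_one_add, Units.val_mul, hP, Module.End.mul_apply]
  have hmU : ∀ i, opU w c V (m i) = (b * w ^ i) • m i := fun i => by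
    have hq : opU w c V * P = w • (P * opU w c V) := by
      rw [hP]
      exact opU_mul_opX hn hw
    have := LinearMap.congr_fun (mul_zpow_of_qcommute hw0 hq i) v
    simp only [Module.End.mul_apply, LinearMap.smul_apply, hv, map_smul, smul_smul] at this
    rw [this, mul_comm]
  have hmY : ∀ i, opY w c V (m i) = (fixedPt w c + b * w ^ i + z) • m (i - 1) := fun i => by
    -- Writing `m i = x (m (i - 1))` reduces the action of `y` to that of `y x` at the eigenvalue `b
    -- w ^ (i - 1)`.
    have h1 := hmX (i - 1)
    rw [sub_add_cancel] at h1
    rw [← h1, opY_opX_apply hn hw c hZ (hmU (i - 1)), mul_left_comm, ← zpow_one_add₀ hw0,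
      add_sub_cancel]
  have hmn : ∀ i, m (i + n) = a • m i := fun i => by
    simp only [m, add_comm i, zpow_add, zpow_natCast, Units.val_mul, Units.val_pow_eq_pow_val, hP,
      hX, smul_mul_assoc, one_mul, LinearMap.smul_apply]
  obtain ⟨Φ, hΦ⟩ := exists_hom_cls_T (subA _ _ z n (orbit_period hn hw c b) a)
    (fun _ => Iff.rfl) m hmn fun g i => by
      cases g with
      | x => simp [Rep.op, repA, shift_T, laurentLift_T, hmX]
      | h => simp [Rep.op, repA, shift_T, laurentLift_T, act_h_apply_eq c (hmU i), orbit]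
      | y => simp [Rep.op, repA, shift_T, laurentLift_T, hmY, orbit, sub_eq_add_neg]
  exact ⟨Φ, (hΦ 0).trans (by simp [m])⟩

end A

/-! ### The modules `B'` -/

section B

variable (b : ℂ) (j : ℤ) (a : ℂ)

/-- The class of `t ^ i` in `B'`. -/
def bVec (i : ℤ) : BMod hn hw c b j a :=
  cls (subB _ _ (-(orbit hn hw c b).1 j) n (orbit_period hn hw c b) a) (T i)

theorem opX_bVec (i : ℤ) : opX w c _ (bVec hn hw c b j a i) =
    (b * w ^ (i + 1) - b * w ^ j) • bVec hn hw c b j a (i + 1) := by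
  rw [bVec, bVec, act_cls, ← map_smul]
  refine congrArg _ ((shift_T _ _ _).trans ?_)
  rw [← add_sub_add_left_eq_sub (b * w ^ (i + 1)) (b * w ^ j) (fixedPt w c), sub_eq_add_neg]
  rfl

theorem act_h_bVec (i : ℤ) : act (lin w c) _ .h (bVec hn hw c b j a i) =
    (fixedPt w c + b * w ^ i) • bVec hn hw c b j a i := by
  rw [bVec, act_cls, ← map_smul]
  refine congrArg _ ((shift_T _ _ _).trans ?_)
  rw [add_zero]
  rfl

theorem opU_bVec (i : ℤ) :
    opU w c _ (bVec hn hw c b j a i) = (b * w ^ i) • bVec hn hw c b j a i :=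
  opU_apply_eq c (act_h_bVec hn hw c b j a i)

theorem opY_bVec (i : ℤ) : opY w c _ (bVec hn hw c b j a i) = bVec hn hw c b j a (i - 1) := by
  rw [bVec, act_cls]
  simp [Rep.op, repB, shift_T, bVec, sub_eq_add_neg]

theorem bVec_add (i : ℤ) : bVec hn hw c b j a (i + n) = a • bVec hn hw c b j a i :=
  cls_T_add (fun _ => Iff.rfl) i

variable {a} in
theorem bVec_ne_zero (ha : a ≠ 0) (i : ℤ) : bVec hn hw c b j a i ≠ 0 :=
  cls_T_ne_zero hn ha (fun _ => Iff.rfl) i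

variable {a} in
-- Here `y` lowers exponents, so its `n`-th power is `t ^ (-n) = a⁻¹`.
theorem bMod_opY_pow (ha : a ≠ 0) : opY w c (BMod hn hw c b j a) ^ n = a⁻¹ • 1 := by
  have h : ∀ (k : ℕ) (i : ℤ), (opY w c (BMod hn hw c b j a) ^ k) (bVec hn hw c b j a i) =
      bVec hn hw c b j a (i - k) := by
    intro k
    induction k with
    | zero => simp
    | succ k ih =>
      intro i
      rw [pow_succ, Module.End.mul_apply, opY_bVec, ih]
      congr 1
      push_cast
      ring
  refine cls_T_ext _ fun i => (h n i).trans ?_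
  have := bVec_add hn hw c b j a (i - n)
  rw [sub_add_cancel] at this
  exact (inv_smul_eq_iff₀ ha).2 this |>.symm

theorem bMod_opU_pow : opU w c (BMod hn hw c b j a) ^ n = b ^ n • 1 :=
  cls_T_ext _ fun i => (pow_apply_eigen (opU_bVec hn hw c b j a i) n).trans (by
    rw [mul_pow, ← zpow_natCast (w ^ i), zpow_comm, zpow_natCast, hw.pow_eq_one, one_zpow, mul_one]
    rfl)

theorem bMod_opZ : opZ w c (BMod hn hw c b j a) = (-(fixedPt w c + b * w ^ j)) • 1 :=
  cls_T_ext _ fun i => opZ_apply_eq c (act_h_bVec hn hw c b j a i) (by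
    have := opY_bVec hn hw c b j a i
    rw [bVec] at this
    rw [this, opX_bVec, sub_add_cancel, ← sub_eq_add_neg, add_sub_add_left_eq_sub]
    rfl)

variable {a b}

theorem bMod_finrank (hb : b ≠ 0) (ha : a ≠ 0) : Module.finrank ℂ (BMod hn hw c b j a) = n :=
  finrank_laurent hn ha (fun _ => Iff.rfl) hw hb (opU_bVec hn hw c b j a)

theorem bMod_isSimple (hb : b ≠ 0) (ha : a ≠ 0) :
    IsSimpleModule (H (lin w c)) (BMod hn hw c b j a) :=
  isSimpleModule_of_opY hn hw (bMod_finrank hn hw c j hb ha) (pow_ne_zero n hb) (inv_ne_zero ha)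
    (bMod_opU_pow hn hw c b j a) (bMod_opY_pow hn hw c b j ha)

variable {j}

/-- The mirror image of the case of `A'`: now `y` is invertible, `t ^ i` goes to `y ^ (-i) v`, and
`y⁻¹` multiplies `U`-eigenvalues by `w`. -/
theorem exists_hom_bMod (ha : a ≠ 0) (hY : opY w c V ^ n = a⁻¹ • 1)
    (hZ : opZ w c V = (-(fixedPt w c + b * w ^ j)) • 1) {v : V} (hv : opU w c V v = b • v) :
    ∃ Φ : BMod hn hw c b j a →ₗ[H (lin w c)] V, Φ (bVec hn hw c b j a 0) = v := by
  have hw0 : w ≠ 0 := hw.ne_zero (by omega)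
  have hunit : IsUnit (opY w c V) := by
    rw [← isUnit_pow_iff (by omega : n ≠ 0), hY, ← Algebra.algebraMap_eq_smul_one]
    exact (isUnit_iff_ne_zero.2 (inv_ne_zero ha)).map _
  obtain ⟨P, hP⟩ := hunit
  let m : ℤ → V := fun i => ((P⁻¹ ^ i : (Module.End ℂ V)ˣ) : Module.End ℂ V) v
  have hmY : ∀ i, opY w c V (m i) = m (i - 1) := fun i => by
    simp only [m, ← hP, ← Module.End.mul_apply, ← Units.val_mul, inv_zpow', neg_sub]
    rw [← zpow_one_add, sub_eq_add_neg]
  have hmU : ∀ i, opU w c V (m i) = (b * w ^ i) • m i := fun i => by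
    have hq : opU w c V * (P⁻¹ : (Module.End ℂ V)ˣ) =
        w • ((P⁻¹ : (Module.End ℂ V)ˣ) * opU w c V) := by
      have h1 : (P : Module.End ℂ V) * opU w c V = w • (opU w c V * P) := by
        rw [hP]
        exact opY_mul_opU hn hw
      calc opU w c V * (P⁻¹ : (Module.End ℂ V)ˣ) = (P⁻¹ : (Module.End ℂ V)ˣ) *
            ((P : Module.End ℂ V) * opU w c V) * (P⁻¹ : (Module.End ℂ V)ˣ) := by
            rw [Units.inv_mul_cancel_left]
        _ = w • ((P⁻¹ : (Module.End ℂ V)ˣ) * opU w c V) := by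
            rw [h1, mul_smul_comm, smul_mul_assoc, ← mul_assoc, Units.mul_inv_cancel_right]
    have := LinearMap.congr_fun (mul_zpow_of_qcommute hw0 hq i) v
    simp only [Module.End.mul_apply, LinearMap.smul_apply, hv, map_smul, smul_smul] at this
    rw [this, mul_comm]
  have hmX : ∀ i, opX w c V (m i) = (b * w ^ (i + 1) - b * w ^ j) • m (i + 1) := fun i => by
    have h1 := hmY (i + 1)
    rw [add_sub_cancel_right] at h1
    rw [← h1, opX_opY_apply c hZ (hmU (i + 1)), ← sub_eq_add_neg, add_sub_add_left_eq_sub]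
  have hmn : ∀ i, m (i + n) = a • m i := fun i => by
    have h1 : m i = a⁻¹ • m (i + n) := by
      have : P⁻¹ ^ i = P ^ n * P⁻¹ ^ (i + n) := by
        rw [add_comm, zpow_add, zpow_natCast, inv_pow, mul_inv_cancel_left]
      simp only [m]
      rw [this, Units.val_mul, Units.val_pow_eq_pow_val, hP, hY, smul_mul_assoc, one_mul,
        LinearMap.smul_apply]
    rw [h1, smul_inv_smul₀ ha]
  obtain ⟨Φ, hΦ⟩ := exists_hom_cls_T
    (subB _ _ (-(orbit hn hw c b).1 j) n (orbit_period hn hw c b) a)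
    (fun _ => Iff.rfl) m hmn fun g i => by
      cases g with
      | x =>
        simp only [Rep.op, repB, shift_T, map_smul, laurentLift_T, hmX, orbit,
          ← sub_eq_add_neg, add_sub_add_left_eq_sub]
      | h => simp [Rep.op, repB, shift_T, laurentLift_T, act_h_apply_eq c (hmU i), orbit]
      | y => simp [Rep.op, repB, shift_T, laurentLift_T, hmY, sub_eq_add_neg]
  exact ⟨Φ, (hΦ 0).trans (by simp [m])⟩

end B

/-! ### The modules `C` -/

section C

variable (z : ℂ)

theorem iter_lin_eq (i : ℕ) :
    iter (lin w c) z i = fixedPt w c + -(z + fixedPt w c) * w ^ i := by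
  induction i with
  | zero => simp [iter]
  | succ i ih =>
    rw [← eval_iter, ih, eval_lin (hw.ne_one hn)]
    ring

/-- The class of `t ^ i` in `C`. -/
def cVec (i : ℕ) : CMod hn hw c z := cls (subC _ z n (iter_lin hn hw c z)) (X ^ i)

theorem opX_cVec (i : ℕ) : opX w c _ (cVec hn hw c z i) = cVec hn hw c z (i + 1) := by
  rw [cVec, act_cls]
  simp [Rep.op, repC, polyOp_X, cVec]

theorem act_h_cVec (i : ℕ) : act (lin w c) _ .h (cVec hn hw c z i) =
    (fixedPt w c + -(z + fixedPt w c) * w ^ i) • cVec hn hw c z i := by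
  rw [cVec, act_cls, ← map_smul, ← iter_lin_eq hn hw]
  exact congrArg _ (polyOp_X _ _ _)

theorem opU_cVec (i : ℕ) :
    opU w c _ (cVec hn hw c z i) = (-(z + fixedPt w c) * w ^ i) • cVec hn hw c z i :=
  opU_apply_eq c (act_h_cVec hn hw c z i)

theorem opY_cVec_zero : opY w c _ (cVec hn hw c z 0) = 0 := by
  rw [cVec, act_cls, ← map_zero (cls _)]
  refine congrArg _ ((polyOp_X _ _ _).trans ?_)
  rw [iter_lin_eq hn hw]
  simp

theorem opY_cVec_succ (i : ℕ) : opY w c _ (cVec hn hw c z (i + 1)) =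
    (fixedPt w c + -(z + fixedPt w c) * w ^ (i + 1) + z) • cVec hn hw c z i := by
  rw [cVec, cVec, act_cls, ← map_smul, ← iter_lin_eq hn hw, add_comm _ z]
  exact congrArg _ (polyOp_X _ _ _)

theorem cVec_eq_zero_iff (i : ℕ) : cVec hn hw c z i = 0 ↔ n ≤ i :=
  cls_X_eq_zero_iff (fun _ => Iff.rfl) i

theorem cMod_opY_pow : opY w c (CMod hn hw c z) ^ n = 0 := by
  have h : ∀ (k i : ℕ), i < k → (opY w c (CMod hn hw c z) ^ k) (cVec hn hw c z i) = 0 := by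
    intro k
    induction k with
    | zero => simp
    | succ k ih =>
      intro i hi
      rw [pow_succ, Module.End.mul_apply]
      cases i with
      | zero => rw [opY_cVec_zero, map_zero]
      | succ i => rw [opY_cVec_succ, map_smul, ih i (by omega), smul_zero]
  refine cls_X_ext _ fun i => ?_
  rcases lt_or_ge i n with hi | hi
  · exact h n i hi
  · have : cls (subC _ z n (iter_lin hn hw c z)) (X ^ i) = 0 := (cVec_eq_zero_iff hn hw c z i).2 hi
    rw [this, map_zero, map_zero]

theorem cMod_opU_pow : opU w c (CMod hn hw c z) ^ n = (-(z + fixedPt w c)) ^ n • 1 :=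
  cls_X_ext _ fun i => (pow_apply_eigen (opU_cVec hn hw c z i) n).trans (by
    rw [mul_pow, ← pow_mul, mul_comm i, pow_mul, hw.pow_eq_one, one_pow, mul_one]
    rfl)

theorem cMod_opZ : opZ w c (CMod hn hw c z) = z • 1 :=
  cls_X_ext _ fun i => opZ_apply_eq c (act_h_cVec hn hw c z i) (by
    cases i with
    | zero =>
      have := opY_cVec_zero hn hw c z
      rw [cVec] at this
      rw [this, map_zero, pow_zero, mul_one]
      -- The coefficient `e - (z + e) + z` is zero, in agreement with `y 1 = 0`.
      ring_nf
      rw [zero_smul]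
    | succ i =>
      have := opY_cVec_succ hn hw c z i
      rw [cVec] at this
      rw [this, map_smul, opX_cVec]
      rfl)

variable {z}

omit hn hw in
theorem add_fixedPt_ne_zero (hz : z ≠ -fixedPt w c) : -(z + fixedPt w c) ≠ 0 := by
  rwa [Ne, neg_eq_zero, add_eq_zero_iff_eq_neg]

theorem cMod_finrank (hz : z ≠ -fixedPt w c) : Module.finrank ℂ (CMod hn hw c z) = n :=
  finrank_poly (fun _ => Iff.rfl) hw (add_fixedPt_ne_zero c hz) (opU_cVec hn hw c z)

theorem cMod_isSimple (hz : z ≠ -fixedPt w c) :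
    IsSimpleModule (H (lin w c)) (CMod hn hw c z) :=
  isSimpleModule_of_opY_pow_eq_zero hn hw (cMod_finrank hn hw c hz)
    (pow_ne_zero n (add_fixedPt_ne_zero c hz)) (cMod_opU_pow hn hw c z)
    (cMod_opY_pow hn hw c z)

/-- The vectors `x ^ i v` with `i ≥ 0` suffice: `x ^ n = 0` cuts the sequence off above, and `y v =
0` below. -/
theorem exists_hom_cMod (hX : opX w c V ^ n = 0) (hZ : opZ w c V = z • 1) {v : V}
    (hv : opU w c V v = (-(z + fixedPt w c)) • v) (hv' : opY w c V v = 0) :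
    ∃ Φ : CMod hn hw c z →ₗ[H (lin w c)] V, Φ (cVec hn hw c z 0) = v := by
  let m : ℕ → V := fun i => (opX w c V ^ i) v
  have hmX : ∀ i, opX w c V (m i) = m (i + 1) := fun i => by
    simp only [m, pow_succ', Module.End.mul_apply]
  have hmU : ∀ i, opU w c V (m i) = (-(z + fixedPt w c) * w ^ i) • m i :=
    fun i => opU_opX_pow hn hw hv i
  have hmY : ∀ i, opY w c V (m (i + 1)) =
      (fixedPt w c + -(z + fixedPt w c) * w ^ (i + 1) + z) • m i := fun i => by
    rw [← hmX, opY_opX_apply hn hw c hZ (hmU i), pow_succ', mul_left_comm]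
  obtain ⟨Φ, hΦ⟩ := exists_hom_cls_X (subC _ z n (iter_lin hn hw c z))
    (fun _ => Iff.rfl) m (fun i => by simp [m, pow_add, hX]) fun g i => by
      cases g with
      | x => simp [Rep.op, repC, polyOp_X, polyLift_X, hmX]
      | h => simp [Rep.op, repC, polyOp_X, polyLift_X, act_h_apply_eq c (hmU i), iter_lin_eq hn hw]
      | y =>
        cases i with
        | zero =>
          -- The exponent `0 - 1` truncates to `0`, harmlessly, since its coefficient `z + e - (z +
          -- e)` vanishes.
          simp only [Rep.op, repC, polyOp_X, iter_lin_eq hn hw, m]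
          simp [hv']
        | succ i =>
          simp [Rep.op, repC, polyOp_X, polyLift_X, hmY, iter_lin_eq hn hw, add_comm z]
  exact ⟨Φ, (hΦ 0).trans (by simp [m])⟩

end C

/-! ### The one-dimensional modules -/

section One

variable (a b : ℂ)

/-- The basis vector of the one-dimensional module. -/
def oneVec : OneMod hn hw c a b := Rep.of _ (1 : ℂ)

theorem act_oneMod (g : Gen) (v : OneMod hn hw c a b) : act (lin w c) _ g v =
    (match g with | .x => a | .h => fixedPt w c | .y => b) • v := by
  cases g <;> exact Rep.act_of _ _ (show ℂ from v)

theorem oneMod_finrank : Module.finrank ℂ (OneMod hn hw c a b) = 1 :=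
  (Rep.of _).finrank_eq.symm.trans (Module.finrank_self ℂ)

theorem oneMod_isSimple : IsSimpleModule (H (lin w c)) (OneMod hn hw c a b) := by
  refine isSimpleModule_of_forall_eq_top one_pos (oneMod_finrank hn hw c a b)
    fun W v hv hv0 => eq_top_iff.2 fun u _ => ?_
  obtain ⟨r, rfl⟩ := (finrank_eq_one_iff_of_nonzero' v hv0).1 (oneMod_finrank hn hw c a b) u
  exact W.smul_of_tower_mem r hv

variable {a b}

theorem exists_hom_oneMod (hX : opX w c V = a • 1) (hU : opU w c V = 0) (hY : opY w c V = b • 1)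
    (v : V) : ∃ Φ : OneMod hn hw c a b →ₗ[H (lin w c)] V, Φ (oneVec hn hw c a b) = v := by
  refine ⟨homOfCommute (LinearMap.toSpanSingleton ℂ V v ∘ₗ (Rep.of _).symm.toLinearMap)
    fun g u => ?_, one_smul ℂ v⟩
  rw [act_oneMod, map_smul]
  cases g with
  | x => exact (LinearMap.congr_fun hX _).symm
  | h =>
    rw [act_h_eq, hU, zero_add]
    rfl
  | y => exact (LinearMap.congr_fun hY _).symm

end One

end Models

/-! ### Classification of the irreducible modules and of their isomorphisms -/

section Classification

variable {n : ℕ} (hn : 1 < n) {w : ℂ} (hw : IsPrimitiveRoot w n) (c : ℂ)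
  {V : Type*} [AddCommGroup V] [Module ℂ V] [Module (H (lin w c)) V]
  [IsScalarTower ℂ (H (lin w c)) V]
  {V' : Type*} [AddCommGroup V'] [Module ℂ V'] [Module (H (lin w c)) V']
  [IsScalarTower ℂ (H (lin w c)) V']

/-- A subspace that is stable under the generators, as an `𝓗(f)`-submodule. -/
def submoduleOfStable {f : ℂ[X]} {V : Type*} [AddCommGroup V] [Module ℂ V] [Module (H f) V]
    [IsScalarTower ℂ (H f) V] (K : Submodule ℂ V) (hK : ∀ g, ∀ v ∈ K, act f V g v ∈ K) :
    Submodule (H f) V where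
  carrier := K
  add_mem' := K.add_mem
  zero_mem' := K.zero_mem
  smul_mem' := by
    intro u v hv
    induction u using H.induction generalizing v with
    | hs r =>
      rw [algebraMap_smul]
      exact K.smul_mem r hv
    | hg g => exact hK g v hv
    | hm a b h1 h2 =>
      rw [mul_smul]
      exact h1 (h2 hv)
    | ha a b h1 h2 =>
      rw [add_smul]
      exact K.add_mem (h1 hv) (h2 hv)

include hn hw in
-- The kernel of `U` is a submodule, because `U` commutes with `x` and `y` up to the nonzero scalar
-- `w`.
theorem opU_eq_zero_of_apply_eq_zero [IsSimpleModule (H (lin w c)) V] {v : V} (hv0 : v ≠ 0)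
    (hv : opU w c V v = 0) : opU w c V = 0 := by
  let W : Submodule (H (lin w c)) V :=
    submoduleOfStable (LinearMap.ker (opU w c V)) fun g v hv => by
      rw [LinearMap.mem_ker] at hv ⊢
      cases g with
      | x =>
        have := LinearMap.congr_fun (opU_mul_opX hn hw (c := c) (V := V)) v
        simpa [hv] using this
      | h =>
        rw [act_h_eq, LinearMap.add_apply, hv, zero_add, LinearMap.smul_apply, map_smul,
          Module.End.one_apply, hv, smul_zero]
      | y =>
        have := LinearMap.congr_fun (opY_mul_opU hn hw (c := c) (V := V)) v
        simp only [Module.End.mul_apply, LinearMap.smul_apply, hv, map_zero] at this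
        exact (smul_eq_zero.1 this.symm).resolve_left (hw.ne_zero (by omega))
  have hW : W = ⊤ := (eq_bot_or_eq_top W).resolve_left fun h => hv0 <| by
    have : v ∈ W := hv
    rwa [h, Submodule.mem_bot] at this
  ext u
  have : u ∈ W := hW ▸ Submodule.mem_top
  exact this

include hn hw in
-- With `U = 0` the operators of `x` and `y` commute, so Schur's lemma makes both of them scalars.
theorem exists_equiv_oneMod_of_opU_eq_zero [IsSimpleModule (H (lin w c)) V]
    (hU : opU w c V = 0) :
    ∃ a b : ℂ, Nonempty (V ≃ₗ[H (lin w c)] OneMod hn hw c a b) := by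
  have := IsSimpleModule.nontrivial (H (lin w c)) V
  have hYX := opY_mul_opX hn hw (c := c) (V := V)
  rw [hU, smul_zero, add_zero] at hYX
  obtain ⟨a, ha⟩ := exists_eq_smul_of_commute (f := lin w c) (opX w c V) fun g =>
    commute_act_of_commute rfl (by rw [hU, mul_zero, zero_mul]) hYX.symm g
  obtain ⟨b, hb⟩ := exists_eq_smul_of_commute (f := lin w c) (opY w c V) fun g =>
    commute_act_of_commute hYX (by rw [hU, mul_zero, zero_mul]) rfl g
  obtain ⟨v, hv⟩ := exists_ne (0 : V)
  obtain ⟨Φ, hΦ⟩ := exists_hom_oneMod hn hw c ha hU hb v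
  have := oneMod_isSimple hn hw c a b
  obtain ⟨e⟩ := nonempty_equiv_of_hom Φ (hΦ.trans_ne hv)
  exact ⟨a, b, ⟨e.symm⟩⟩

theorem finiteDimensional_of_equiv (φ : V ≃ₗ[H (lin w c)] V')
    (h : 0 < Module.finrank ℂ V') : FiniteDimensional ℂ V := by
  have := Module.finite_of_finrank_pos h
  exact Module.Finite.equiv (φ.restrictScalars ℂ).symm

/-- The classification of the irreducible modules over `𝓗(w h + c)`. -/
theorem classification [IsSimpleModule (H (lin w c)) V] :
    (∃ a b : ℂ, Nonempty (V ≃ₗ[H (lin w c)] OneMod hn hw c a b)) ∨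
    (∃ b z a : ℂ, b ≠ 0 ∧ a ≠ 0 ∧ Nonempty (V ≃ₗ[H (lin w c)] AMod hn hw c b z a)) ∨
    (∃ (b : ℂ) (j : ℤ) (a : ℂ), b ≠ 0 ∧ a ≠ 0 ∧
      Nonempty (V ≃ₗ[H (lin w c)] BMod hn hw c b j a)) ∨
    (∃ z : ℂ, z ≠ -fixedPt w c ∧ Nonempty (V ≃ₗ[H (lin w c)] CMod hn hw c z)) := by
  have := IsSimpleModule.nontrivial (H (lin w c)) V
  obtain ⟨s, hs⟩ := exists_eq_smul_of_commute (opU w c V ^ n) (opU_pow_commute hn hw)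
  obtain ⟨α, hα⟩ := exists_eq_smul_of_commute (opX w c V ^ n) (opX_pow_commute hn hw)
  obtain ⟨γ, hγ⟩ := exists_eq_smul_of_commute (opY w c V ^ n) (opY_pow_commute hn hw)
  obtain ⟨z, hz⟩ := exists_eq_smul_of_commute (opZ w c V) (opZ_commute hn hw)
  obtain ⟨v₀, hv₀⟩ := exists_ne (0 : V)
  by_cases hU : opU w c V = 0
  · exact Or.inl (exists_equiv_oneMod_of_opU_eq_zero hn hw c hU)
  have hβ : ∀ {β : ℂ} {v : V}, v ≠ 0 → opU w c V v = β • v → β ≠ 0 := by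
    rintro β v hv0 hv rfl
    exact hU (opU_eq_zero_of_apply_eq_zero hn hw c hv0 (by rw [hv, zero_smul]))
  right
  by_cases hα0 : α = 0
  · right
    by_cases hγ0 : γ = 0
    · right
      obtain ⟨v₁, -, hv₁, hv₁'⟩ := exists_ker_of_pow_eq_zero (by rw [hγ, hγ0, zero_smul])
        (p := fun _ => True) (fun _ _ => trivial) trivial hv₀
      obtain ⟨β, v, hvY, hv0, hv⟩ := exists_eigenvector_mem_of_pow_eq_smul hn hs
        (K := LinearMap.ker (opY w c V)) (fun v hv => by
          have := LinearMap.congr_fun (opY_mul_opU hn hw (c := c) (V := V)) v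
          rw [LinearMap.mem_ker] at hv ⊢
          simpa [hv] using this) hv₁' hv₁
      have h1 := opX_opY_apply c hz hv
      rw [LinearMap.mem_ker.1 hvY, map_zero, eq_comm, smul_eq_zero, or_iff_left hv0] at h1
      -- On `ker y` the operator `x y` vanishes, so `e + β + z = 0`.
      have h2 : β = -(z + fixedPt w c) := by linear_combination h1
      subst h2
      have hz' : z ≠ -fixedPt w c := by
        rintro rfl
        exact hβ hv0 hv (by ring)
      obtain ⟨Φ, hΦ⟩ := exists_hom_cMod hn hw c (by rw [hα, hα0, zero_smul]) hz hv hvY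
      have := cMod_isSimple hn hw c hz'
      obtain ⟨e⟩ := nonempty_equiv_of_hom Φ (hΦ.trans_ne hv0)
      exact ⟨z, hz', ⟨e.symm⟩⟩
    · left
      obtain ⟨v₁, -, hv₁, hv₁'⟩ := exists_ker_of_pow_eq_zero (by rw [hα, hα0, zero_smul])
        (p := fun _ => True) (fun _ _ => trivial) trivial hv₀
      obtain ⟨β, v, hvX, hv0, hv⟩ := exists_eigenvector_mem_of_pow_eq_smul hn hs
        (K := LinearMap.ker (opX w c V)) (fun v hv => by
          have := LinearMap.congr_fun (opU_mul_opX hn hw (c := c) (V := V)) v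
          rw [LinearMap.mem_ker] at hv ⊢
          simp only [Module.End.mul_apply, LinearMap.smul_apply, hv, map_zero] at this
          exact (smul_eq_zero.1 this.symm).resolve_left (hw.ne_zero (by omega))) hv₁' hv₁
      have h1 := opY_opX_apply hn hw c hz hv
      rw [LinearMap.mem_ker.1 hvX, map_zero, eq_comm, smul_eq_zero, or_iff_left hv0] at h1
      -- On `ker x` the operator `y x` vanishes, so `e + w β + z = 0`; this is the parameter `j =
      -- 1`.
      have h2 : z = -(fixedPt w c + β * w ^ (1 : ℤ)) := by
        rw [zpow_one]
        linear_combination h1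
      -- On `B'` the scalar of `y ^ n` is the inverse of the parameter, hence `a = γ⁻¹`.
      obtain ⟨Φ, hΦ⟩ := exists_hom_bMod hn hw c (inv_ne_zero hγ0) (by rwa [inv_inv])
        (h2 ▸ hz) hv
      have := bMod_isSimple hn hw c 1 (hβ hv0 hv) (inv_ne_zero hγ0)
      obtain ⟨e⟩ := nonempty_equiv_of_hom Φ (hΦ.trans_ne hv0)
      exact ⟨β, 1, γ⁻¹, hβ hv0 hv, inv_ne_zero hγ0, ⟨e.symm⟩⟩
  -- When `x` is invertible any `U`-eigenvector will do, so the subspace is the whole module.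
  · left
    obtain ⟨β, v, -, hv0, hv⟩ := exists_eigenvector_mem_of_pow_eq_smul hn hs
      (K := ⊤) (fun _ _ => trivial) (Submodule.mem_top (x := v₀)) hv₀
    obtain ⟨Φ, hΦ⟩ := exists_hom_aMod hn hw c hα0 hα hz hv
    have := aMod_isSimple hn hw c z (hβ hv0 hv) hα0
    obtain ⟨e⟩ := nonempty_equiv_of_hom Φ (hΦ.trans_ne hv0)
    exact ⟨β, z, α, hβ hv0 hv, hα0, ⟨e.symm⟩⟩

/-! ### Invariants -/

theorem equiv_pow_apply {R V V' : Type*} [Ring R] [AddCommGroup V] [Module R V] [Module ℂ V]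
    [AddCommGroup V'] [Module R V'] [Module ℂ V'] (φ : V ≃ₗ[R] V') {P : Module.End ℂ V}
    {P' : Module.End ℂ V'} (h : ∀ v, φ (P v) = P' (φ v)) (k : ℕ) (v : V) :
    φ ((P ^ k) v) = (P' ^ k) (φ v) := by
  induction k generalizing v with
  | zero => rfl
  | succ k ih => rw [pow_succ, pow_succ, Module.End.mul_apply, Module.End.mul_apply, ih, h]

theorem equiv_opU (φ : V ≃ₗ[H (lin w c)] V') (v : V) : φ (opU w c V v) = opU w c V' (φ v) := by
  have h : φ (fixedPt w c • v) = fixedPt w c • φ v := map_smul (φ.restrictScalars ℂ) _ _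
  rw [opU, opU, LinearMap.sub_apply, LinearMap.sub_apply, map_sub, equiv_act, LinearMap.smul_apply,
    LinearMap.smul_apply, Module.End.one_apply, Module.End.one_apply, h]

theorem equiv_opZ (φ : V ≃ₗ[H (lin w c)] V') (v : V) : φ (opZ w c V v) = opZ w c V' (φ v) := by
  rw [opZ, opZ, LinearMap.sub_apply, LinearMap.sub_apply, map_sub, Module.End.mul_apply,
    Module.End.mul_apply, equiv_act, equiv_act, equiv_act]

/-- Scalars of operators that the isomorphism intertwines are invariants; this recovers the
parameters of each family. -/
theorem eq_of_equiv {f : ℂ[X]} {V V' : Type*} [AddCommGroup V] [Module ℂ V] [Module (H f) V]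
    [IsScalarTower ℂ (H f) V] [AddCommGroup V'] [Module ℂ V'] [Module (H f) V']
    [IsScalarTower ℂ (H f) V'] (φ : V ≃ₗ[H f] V') {P : Module.End ℂ V} {P' : Module.End ℂ V'}
    (h : ∀ v, φ (P v) = P' (φ v)) {s t : ℂ} (hP : P = s • 1) (hP' : P' = t • 1) {v : V}
    (hv : v ≠ 0) : s = t := by
  have h1 := h v
  have h2 : φ (s • v) = s • φ v := map_smul (φ.restrictScalars ℂ) _ _
  rw [hP, hP', LinearMap.smul_apply, LinearMap.smul_apply, Module.End.one_apply,
    Module.End.one_apply, h2] at h1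
  exact smul_left_injective ℂ ((map_ne_zero_iff φ φ.injective).2 hv) h1

theorem finrank_eq_of_equiv (φ : V ≃ₗ[H (lin w c)] V') :
    Module.finrank ℂ V = Module.finrank ℂ V' := (φ.restrictScalars ℂ).finrank_eq

theorem nonempty_equiv_oneMod_iff (a b a' b' : ℂ) :
    Nonempty (OneMod hn hw c a b ≃ₗ[H (lin w c)] OneMod hn hw c a' b') ↔ a = a' ∧ b = b' := by
  constructor
  · rintro ⟨φ⟩
    have hv : oneVec hn hw c a b ≠ 0 := one_ne_zero (α := ℂ)
    exact ⟨eq_of_equiv φ (equiv_act φ .x) (LinearMap.ext fun v => act_oneMod hn hw c a b .x v)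
        (LinearMap.ext fun v => act_oneMod hn hw c a' b' .x v) hv,
      eq_of_equiv φ (equiv_act φ .y) (LinearMap.ext fun v => act_oneMod hn hw c a b .y v)
        (LinearMap.ext fun v => act_oneMod hn hw c a' b' .y v) hv⟩
  · rintro ⟨rfl, rfl⟩
    exact ⟨LinearEquiv.refl _ _⟩

theorem nonempty_equiv_aMod_iff {b z a b' z' a' : ℂ} (hb : b ≠ 0) (ha : a ≠ 0) (hb' : b' ≠ 0)
    (ha' : a' ≠ 0) : Nonempty (AMod hn hw c b z a ≃ₗ[H (lin w c)] AMod hn hw c b' z' a') ↔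
      (∃ k : ℤ, b' = b * w ^ k) ∧ z = z' ∧ a = a' := by
  constructor
  · rintro ⟨φ⟩
    have hv := aVec_ne_zero hn hw c b z ha 0
    refine ⟨?_, eq_of_equiv φ (equiv_opZ c φ) (aMod_opZ ..) (aMod_opZ ..) hv,
      eq_of_equiv φ (equiv_pow_apply φ (equiv_act φ .x) n) (aMod_opX_pow ..) (aMod_opX_pow ..) hv⟩
    -- `U ^ n` determines `b ^ n`, that is, `b` up to an `n`-th root of unity, which is a power of
    -- `w`.
    have hbn := eq_of_equiv φ (equiv_pow_apply φ (equiv_opU c φ) n) (aMod_opU_pow ..)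
      (aMod_opU_pow ..) hv
    have : NeZero n := ⟨by omega⟩
    obtain ⟨i, -, hi⟩ := hw.eq_pow_of_pow_eq_one (ξ := b' / b)
      (by rw [div_pow, hbn, div_self (pow_ne_zero n hb')])
    exact ⟨i, by rw [zpow_natCast, hi, mul_div_cancel₀ _ hb]⟩
  · rintro ⟨⟨k, rfl⟩, rfl, rfl⟩
    have := aMod_isSimple hn hw c z hb ha
    have := aMod_isSimple hn hw c z hb' ha
    -- The class of `t ^ k` is an eigenvector for `b w ^ k`, so it can serve as the image of `1`.
    obtain ⟨Φ, hΦ⟩ := exists_hom_aMod hn hw c ha (aMod_opX_pow hn hw c b z a)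
      (aMod_opZ hn hw c b z a) (opU_aVec hn hw c b z a k)
    obtain ⟨e⟩ := nonempty_equiv_of_hom Φ (hΦ.trans_ne (aVec_ne_zero hn hw c b z ha k))
    exact ⟨e.symm⟩

theorem nonempty_equiv_bMod_iff {b : ℂ} {j : ℤ} {a b' : ℂ} {j' : ℤ} {a' : ℂ} (hb : b ≠ 0)
    (ha : a ≠ 0) (hb' : b' ≠ 0) (ha' : a' ≠ 0) :
    Nonempty (BMod hn hw c b j a ≃ₗ[H (lin w c)] BMod hn hw c b' j' a') ↔
      b * w ^ j = b' * w ^ j' ∧ a = a' := by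
  constructor
  · rintro ⟨φ⟩
    have hv := bVec_ne_zero hn hw c b j ha 0
    have hZ := eq_of_equiv φ (equiv_opZ c φ) (bMod_opZ ..) (bMod_opZ ..) hv
    have hY := eq_of_equiv φ (equiv_pow_apply φ (equiv_act φ .y) n)
      (bMod_opY_pow hn hw c b j ha) (bMod_opY_pow hn hw c b' j' ha') hv
    exact ⟨add_left_cancel (neg_injective hZ), inv_injective hY⟩
  · rintro ⟨h, rfl⟩
    have hw0 : w ≠ 0 := hw.ne_zero (by omega)
    -- The class of `t ^ (j - j')` has `U`-eigenvalue `b'`; it will be the image of `1`.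
    have hbb : b * w ^ (j - j') = b' := by
      rw [zpow_sub₀ hw0, ← mul_div_assoc, h, mul_div_cancel_right₀ _ (zpow_ne_zero _ hw0)]
    have := bMod_isSimple hn hw c j hb ha
    have := bMod_isSimple hn hw c j' hb' ha
    have hv := opU_bVec hn hw c b j a (j - j')
    have hZ := bMod_opZ hn hw c b j a
    rw [hbb] at hv
    rw [h] at hZ
    obtain ⟨Φ, hΦ⟩ := exists_hom_bMod hn hw c ha (bMod_opY_pow hn hw c b j ha) hZ hv
    obtain ⟨e⟩ := nonempty_equiv_of_hom Φ (hΦ.trans_ne (bVec_ne_zero hn hw c b j ha _))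
    exact ⟨e.symm⟩

theorem nonempty_equiv_cMod_iff {z z' : ℂ} :
    Nonempty (CMod hn hw c z ≃ₗ[H (lin w c)] CMod hn hw c z') ↔ z = z' := by
  constructor
  · rintro ⟨φ⟩
    exact eq_of_equiv φ (equiv_opZ c φ) (cMod_opZ ..) (cMod_opZ ..)
      (v := cVec hn hw c z 0) (by rw [Ne, cVec_eq_zero_iff]; omega)
  · rintro rfl
    exact ⟨LinearEquiv.refl _ _⟩

/-- A generator that is injective on one module and has a kernel on the other rules out an
isomorphism. -/
theorem isEmpty_equiv_of_pow_eq_smul (hn : 1 < n) {f : ℂ[X]} {V V' : Type*} [AddCommGroup V]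
    [Module ℂ V] [Module (H f) V] [IsScalarTower ℂ (H f) V] [AddCommGroup V'] [Module ℂ V']
    [Module (H f) V'] [IsScalarTower ℂ (H f) V'] (g : Gen) {a : ℂ} (ha : a ≠ 0)
    (h : act f V g ^ n = a • 1) {v : V'} (hv0 : v ≠ 0) (hv : act f V' g v = 0) :
    IsEmpty (V ≃ₗ[H f] V') := by
  refine ⟨fun φ => hv0 ?_⟩
  have h1 : act f V g (φ.symm v) = 0 := by rw [← equiv_act, hv, map_zero]
  exact φ.symm.map_eq_zero_iff.1 (injective_of_pow_eq_smul hn ha h h1)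

end Classification

end GenHeisenberg

end

/-! ### The main theorem -/

open GenHeisenberg in
theorem mainTheorem4 {n : ℕ} (hn : 1 < n) {w : ℂ} (hw : IsPrimitiveRoot w n) (c : ℂ) :
    -- every irreducible module is finite-dimensional and occurs in one of the four families
    (∀ (V : Type*) [AddCommGroup V] [Module ℂ V] [Module (H (lin w c)) V]
        [IsScalarTower ℂ (H (lin w c)) V] [IsSimpleModule (H (lin w c)) V],
      FiniteDimensional ℂ V ∧
      ((∃ a b : ℂ, Nonempty (V ≃ₗ[H (lin w c)] OneMod hn hw c a b)) ∨
       (∃ b z a : ℂ, b ≠ 0 ∧ a ≠ 0 ∧ Nonempty (V ≃ₗ[H (lin w c)] AMod hn hw c b z a)) ∨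
       (∃ (b : ℂ) (j : ℤ) (a : ℂ), b ≠ 0 ∧ a ≠ 0 ∧
          Nonempty (V ≃ₗ[H (lin w c)] BMod hn hw c b j a)) ∨
       (∃ z : ℂ, z ≠ -fixedPt w c ∧ Nonempty (V ≃ₗ[H (lin w c)] CMod hn hw c z)))) ∧
    -- every member of the four families is irreducible, of dimension `1` or `n`
    (∀ a b : ℂ, IsSimpleModule (H (lin w c)) (OneMod hn hw c a b) ∧
      Module.finrank ℂ (OneMod hn hw c a b) = 1) ∧
    (∀ b z a : ℂ, b ≠ 0 → a ≠ 0 → IsSimpleModule (H (lin w c)) (AMod hn hw c b z a) ∧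
      Module.finrank ℂ (AMod hn hw c b z a) = n) ∧
    (∀ (b : ℂ) (j : ℤ) (a : ℂ), b ≠ 0 → a ≠ 0 →
      IsSimpleModule (H (lin w c)) (BMod hn hw c b j a) ∧
      Module.finrank ℂ (BMod hn hw c b j a) = n) ∧
    (∀ z : ℂ, z ≠ -fixedPt w c → IsSimpleModule (H (lin w c)) (CMod hn hw c z) ∧
      Module.finrank ℂ (CMod hn hw c z) = n) ∧
    -- isomorphisms inside each family
    (∀ a b a' b' : ℂ,
      Nonempty (OneMod hn hw c a b ≃ₗ[H (lin w c)] OneMod hn hw c a' b') ↔ a = a' ∧ b = b') ∧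
    (∀ b z a b' z' a' : ℂ, b ≠ 0 → a ≠ 0 → b' ≠ 0 → a' ≠ 0 →
      (Nonempty (AMod hn hw c b z a ≃ₗ[H (lin w c)] AMod hn hw c b' z' a') ↔
        (∃ k : ℤ, b' = b * w ^ k) ∧ z = z' ∧ a = a')) ∧
    (∀ (b : ℂ) (j : ℤ) (a b' : ℂ) (j' : ℤ) (a' : ℂ), b ≠ 0 → a ≠ 0 → b' ≠ 0 → a' ≠ 0 →
      (Nonempty (BMod hn hw c b j a ≃ₗ[H (lin w c)] BMod hn hw c b' j' a') ↔
        b * w ^ j = b' * w ^ j' ∧ a = a')) ∧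
    (∀ z z' : ℂ, z ≠ -fixedPt w c → z' ≠ -fixedPt w c →
      (Nonempty (CMod hn hw c z ≃ₗ[H (lin w c)] CMod hn hw c z') ↔ z = z')) ∧
    -- no isomorphisms between different families
    (∀ a₀ b₀ b z a : ℂ, b ≠ 0 → a ≠ 0 →
      IsEmpty (OneMod hn hw c a₀ b₀ ≃ₗ[H (lin w c)] AMod hn hw c b z a)) ∧
    (∀ (a₀ b₀ b : ℂ) (j : ℤ) (a : ℂ), b ≠ 0 → a ≠ 0 →
      IsEmpty (OneMod hn hw c a₀ b₀ ≃ₗ[H (lin w c)] BMod hn hw c b j a)) ∧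
    (∀ a₀ b₀ z : ℂ, z ≠ -fixedPt w c →
      IsEmpty (OneMod hn hw c a₀ b₀ ≃ₗ[H (lin w c)] CMod hn hw c z)) ∧
    (∀ (b z a b' : ℂ) (j : ℤ) (a' : ℂ), b ≠ 0 → a ≠ 0 → b' ≠ 0 → a' ≠ 0 →
      IsEmpty (AMod hn hw c b z a ≃ₗ[H (lin w c)] BMod hn hw c b' j a')) ∧
    (∀ b z a z' : ℂ, b ≠ 0 → a ≠ 0 → z' ≠ -fixedPt w c →
      IsEmpty (AMod hn hw c b z a ≃ₗ[H (lin w c)] CMod hn hw c z')) ∧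
    (∀ (b : ℂ) (j : ℤ) (a z' : ℂ), b ≠ 0 → a ≠ 0 → z' ≠ -fixedPt w c →
      IsEmpty (BMod hn hw c b j a ≃ₗ[H (lin w c)] CMod hn hw c z')) := by
  have hA : ∀ b z a : ℂ, b ≠ 0 → a ≠ 0 → IsSimpleModule (H (lin w c)) (AMod hn hw c b z a) ∧
      Module.finrank ℂ (AMod hn hw c b z a) = n := fun b z a hb ha =>
    ⟨aMod_isSimple hn hw c z hb ha, aMod_finrank hn hw c z hb ha⟩
  have hB : ∀ (b : ℂ) (j : ℤ) (a : ℂ), b ≠ 0 → a ≠ 0 →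
      IsSimpleModule (H (lin w c)) (BMod hn hw c b j a) ∧
      Module.finrank ℂ (BMod hn hw c b j a) = n := fun b j a hb ha =>
    ⟨bMod_isSimple hn hw c j hb ha, bMod_finrank hn hw c j hb ha⟩
  have hC : ∀ z : ℂ, z ≠ -fixedPt w c → IsSimpleModule (H (lin w c)) (CMod hn hw c z) ∧
      Module.finrank ℂ (CMod hn hw c z) = n := fun z hz =>
    ⟨cMod_isSimple hn hw c hz, cMod_finrank hn hw c hz⟩
  refine ⟨?_, fun a b => ⟨oneMod_isSimple hn hw c a b, oneMod_finrank hn hw c a b⟩, hA, hB, hC,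
    nonempty_equiv_oneMod_iff hn hw c,
    fun b z a b' z' a' hb ha hb' ha' => nonempty_equiv_aMod_iff hn hw c hb ha hb' ha',
    fun b j a b' j' a' hb ha hb' ha' => nonempty_equiv_bMod_iff hn hw c hb ha hb' ha',
    fun z z' _ _ => nonempty_equiv_cMod_iff hn hw c, ?_, ?_, ?_, ?_, ?_, ?_⟩
  · intro V _ _ _ _ _
    have h := classification hn hw c (V := V)
    refine ⟨?_, h⟩
    obtain ⟨a, b, ⟨φ⟩⟩ | ⟨b, z, a, hb, ha, ⟨φ⟩⟩ | ⟨b, j, a, hb, ha, ⟨φ⟩⟩ | ⟨z, hz, ⟨φ⟩⟩ := h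
    · exact finiteDimensional_of_equiv c φ (by rw [oneMod_finrank hn hw]; omega)
    · exact finiteDimensional_of_equiv c φ (by rw [(hA b z a hb ha).2]; omega)
    · exact finiteDimensional_of_equiv c φ (by rw [(hB b j a hb ha).2]; omega)
    · exact finiteDimensional_of_equiv c φ (by rw [(hC z hz).2]; omega)
  · refine fun a₀ b₀ b z a hb ha => ⟨fun φ => ?_⟩
    have := finrank_eq_of_equiv c φ
    rw [oneMod_finrank hn hw, (hA b z a hb ha).2] at this
    omega
  · refine fun a₀ b₀ b j a hb ha => ⟨fun φ => ?_⟩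
    have := finrank_eq_of_equiv c φ
    rw [oneMod_finrank hn hw, (hB b j a hb ha).2] at this
    omega
  · refine fun a₀ b₀ z hz => ⟨fun φ => ?_⟩
    have := finrank_eq_of_equiv c φ
    rw [oneMod_finrank hn hw, (hC z hz).2] at this
    omega
  · intro b z a b' j a' _ ha _ ha'
    -- On `B'` the generator `x` kills `t ^ (j - 1)`, whose coefficient is `b (w ^ j - w ^ j)`.
    refine isEmpty_equiv_of_pow_eq_smul hn .x ha (aMod_opX_pow hn hw c b z a)
      (bVec_ne_zero hn hw c b' j ha' (j - 1)) ?_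
    rw [opX_bVec, sub_add_cancel, sub_self, zero_smul]
  · intro b z a z' _ ha _
    -- On `C` the top power `t ^ (n - 1)` is nonzero and killed by `x`.
    refine isEmpty_equiv_of_pow_eq_smul hn .x ha (aMod_opX_pow hn hw c b z a)
      (v := cVec hn hw c z' (n - 1)) ?_ ?_
    · rw [Ne, cVec_eq_zero_iff]
      omega
    · rw [opX_cVec, cVec_eq_zero_iff]
      omega
  · intro b j a z' _ ha _
    refine isEmpty_equiv_of_pow_eq_smul hn .y (inv_ne_zero ha) (bMod_opY_pow hn hw c b j ha)
      (v := cVec hn hw c z' 0) ?_ (opY_cVec_zero hn hw c z')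
    rw [Ne, cVec_eq_zero_iff]
    omega
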